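/- Let $\Omega\subset\mathbb R^3$ be a bounded domain with smooth boundary, let $\gamma>0$, $T>0$ and $g\in L^2(\Omega)$, and let $f\in C^1(\mathbb R)$ satisfy the growth bound $|f'(s)|\le C(1+|s|^4)$ for all $s\in\mathbb R$ and some constant $C$. Consider the damped wave equation $$\partial_t^2u+\gamma\partial_tu-\Delta u+f(u)=g\ \text{ in }(0,T)\times\Omega,\qquad u|_{\partial\Omega}=0,\qquad u|_{t=0}=u_0,\quad \partial_tu|_{t=0}=u_0',$$ with $(u_0,u_0')\in H^1_0(\Omega)\times L^2(\Omega)$. A weak solution on $[0,T]$ is a function $u$ with $u\in L^\infty(0,T;H^1_0(\Omega))$ and $\partial_tu\in L^\infty(0,T;L^2(\Omega))$ such that $$-\int_0^T(\partial_tu,\partial_t\phi)\,dt-\gamma\int_0^T(u,\partial_t\phi)\,dt+\int_0^T(\nabla u,\nabla\phi)\,dt+\int_0^T(f(u),\phi)\,dt=\int_0^T(g,\phi)\,dt$$ for all $\phi\in C_0^\infty((0,T)\times\Omega)$, where $(\cdot,\cdot)$ is the inner product of $L^2(\Omega)$, and whose initial data is attained by the representative of $(u,\partial_tu)$ in $C([0,T];L^2(\Omega)\times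 H^{-1}(\Omega))$. A weak solution is a Shatah–Struwe solution if in addition $u\in L^4(0,T;L^{12}(\Omega))$. Then the Shatah–Struwe solution on $[0,T]$ is unique: if $u$ and $v$ are two Shatah–Struwe solutions on $[0,T]$ with the same initial data $(u_0,u_0')$, then $u(t)=v(t)$ and $\partial_tu(t)=\partial_tv(t)$ for almost every $t\in(0,T)$, that is, $u$ and $v$ coincide. -/

import Mathlib

noncomputable section

namespace DampedWave

open Set MeasureTheory Topology
open scoped ContDiff

/-- Three dimensional Euclidean space. -/
abbrev E3 : Type := EuclideanSpace ℝ (Fin 3)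

/-- A bounded domain (nonempty connected open set) with smooth boundary: near each boundary
point the domain is the sublevel set `{ρ < 0}` of a smooth function with nonzero differential. -/
structure IsBoundedSmoothDomain (Ω : Set E3) : Prop where
  isOpen : IsOpen Ω
  isConnected : IsConnected Ω
  isBounded : Bornology.IsBounded Ω
  smooth_boundary : ∀ x ∈ frontier Ω, ∃ U ∈ 𝓝 x, ∃ ρ : E3 → ℝ,
    ContDiff ℝ ∞ ρ ∧ fderiv ℝ ρ x ≠ 0 ∧ Ω ∩ U = {y ∈ U | ρ y < 0}

/-- `C₀^∞(W)`: smooth real functions with compact support contained in `W`. -/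
structure IsTestFunction {X : Type*} [NormedAddCommGroup X] [NormedSpace ℝ X]
    (W : Set X) (φ : X → ℝ) : Prop where
  smooth : ContDiff ℝ ∞ φ
  compact : HasCompactSupport φ
  support_subset : tsupport φ ⊆ W

/-- The real space `L²(Ω)`. -/
abbrev L2 (Ω : Set E3) : Type := Lp ℝ 2 (volume.restrict Ω)

/-- The space `L²(Ω; ℝ³)` of square integrable vector fields. -/
abbrev L2vec (Ω : Set E3) : Type := Lp E3 2 (volume.restrict Ω)

/-- The pairs `(φ, ∇φ)` with `φ ∈ C₀^∞(Ω)`, inside the Hilbert space `L²(Ω) × L²(Ω; ℝ³)`. -/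
def testGraph (Ω : Set E3) : Submodule ℝ (WithLp 2 (L2 Ω × L2vec Ω)) where
  carrier := {p | ∃ φ : E3 → ℝ, IsTestFunction Ω φ ∧
    p.fst =ᵐ[volume.restrict Ω] φ ∧ p.snd =ᵐ[volume.restrict Ω] gradient φ}
  zero_mem' := by
    refine ⟨fun _ => 0, ⟨contDiff_const, HasCompactSupport.zero, by simp [tsupport]⟩, ?_, ?_⟩
    · exact Lp.coeFn_zero _ _ _
    · filter_upwards [Lp.coeFn_zero E3 2 (volume.restrict Ω)] with x hx
      simpa [gradient] using hx
  add_mem' := by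
    rintro p q ⟨φ, hφ, hp₁, hp₂⟩ ⟨ψ, hψ, hq₁, hq₂⟩
    refine ⟨φ + ψ, ⟨hφ.smooth.add hψ.smooth, hφ.compact.add hψ.compact,
      (tsupport_add φ ψ).trans (union_subset hφ.support_subset hψ.support_subset)⟩, ?_, ?_⟩
    · filter_upwards [hp₁, hq₁, Lp.coeFn_add p.fst q.fst] with x h₁ h₂ h
      simp only [WithLp.add_fst, h, Pi.add_apply, h₁, h₂]
    · filter_upwards [hp₂, hq₂, Lp.coeFn_add p.snd q.snd] with x h₁ h₂ h
      have hd₁ := (hφ.smooth.differentiable (by simp)) x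
      have hd₂ := (hψ.smooth.differentiable (by simp)) x
      simp only [WithLp.add_snd, h, Pi.add_apply, h₁, h₂, gradient, fderiv_add hd₁ hd₂, map_add]
  smul_mem' := by
    rintro c p ⟨φ, hφ, hp₁, hp₂⟩
    refine ⟨c • φ, ⟨hφ.smooth.const_smul c, hφ.compact.smul_left,
      (tsupport_smul_subset_right (fun _ => c) φ).trans hφ.support_subset⟩, ?_, ?_⟩
    · filter_upwards [hp₁, Lp.coeFn_smul c p.fst] with x h₁ h
      simp only [WithLp.smul_fst, h, Pi.smul_apply, h₁]
    · filter_upwards [hp₂, Lp.coeFn_smul c p.snd] with x h₁ h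
      have hd := (hφ.smooth.differentiable (by simp)) x
      simp only [WithLp.smul_snd, h, Pi.smul_apply, h₁, gradient, fderiv_const_smul hd, map_smul]

/-- `H¹₀(Ω)`, the closure of `C₀^∞(Ω)` in the `H¹` norm `(‖u‖² + ‖∇u‖²)^(1/2)`. An element
is stored as the pair `(u, ∇u)`. -/
def H10 (Ω : Set E3) : Submodule ℝ (WithLp 2 (L2 Ω × L2vec Ω)) :=
  (testGraph Ω).topologicalClosure

/-- The inclusion `H¹₀(Ω) → L²(Ω)`. -/
def H10.val {Ω : Set E3} : H10 Ω →L[ℝ] L2 Ω :=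
  WithLp.fstL 2 ℝ (L2 Ω) (L2vec Ω) ∘L (H10 Ω).subtypeL

/-- The (weak) gradient `H¹₀(Ω) → L²(Ω; ℝ³)`. -/
def H10.grad {Ω : Set E3} : H10 Ω →L[ℝ] L2vec Ω :=
  WithLp.sndL 2 ℝ (L2 Ω) (L2vec Ω) ∘L (H10 Ω).subtypeL

/-- `H⁻¹(Ω)`, the dual space of `H¹₀(Ω)`. -/
abbrev Hneg1 (Ω : Set E3) : Type := StrongDual ℝ (H10 Ω)

/-- The embedding `L²(Ω) → H⁻¹(Ω)`, which sends `w` to the functional `φ ↦ (w, φ)`. -/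
def toHneg1 {Ω : Set E3} (w : L2 Ω) : Hneg1 Ω :=
  innerSL ℝ w ∘L H10.val

/-- Lebesgue measure on the time interval `(0, T)`. -/
abbrev timeMeasure (T : ℝ) : Measure ℝ := volume.restrict (Ioo 0 T)

/-- The quintic growth bound: `f` is of class `C¹` and `|f'(s)| ≤ C (1 + |s|⁴)`. -/
structure QuinticGrowth (f : ℝ → ℝ) : Prop where
  contDiff : ContDiff ℝ 1 f
  bound : ∃ C : ℝ, ∀ s : ℝ, |deriv f s| ≤ C * (1 + |s| ^ 4)

/-- `v` is the weak time derivative on `(0, T)` of the `L²(Ω)`-valued function `u`. -/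
def HasWeakTimeDeriv {Ω : Set E3} (T : ℝ) (u v : ℝ → L2 Ω) : Prop :=
  ∀ η : ℝ → ℝ, IsTestFunction (Ioo 0 T) η →
    ∫ t in Ioo 0 T, deriv η t • u t = -∫ t in Ioo 0 T, η t • v t

/-- The equation `∂ₜ²u + γ ∂ₜu - Δu + f(u) = g` in the sense of distributions on `(0, T) × Ω`,
where `ut` stands for `∂ₜu`. -/
def SatisfiesEquation (Ω : Set E3) (T γ : ℝ) (f : ℝ → ℝ) (g : L2 Ω)
    (u : ℝ → H10 Ω) (ut : ℝ → L2 Ω) : Prop :=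
  ∀ φ : ℝ → E3 → ℝ, IsTestFunction (Ioo 0 T ×ˢ Ω) (Function.uncurry φ) →
    -(∫ t in Ioo 0 T, ∫ x in Ω, ut t x * deriv (fun s => φ s x) t)
      - γ * (∫ t in Ioo 0 T, ∫ x in Ω, H10.val (u t) x * deriv (fun s => φ s x) t)
      + (∫ t in Ioo 0 T, ∫ x in Ω, inner ℝ (H10.grad (u t) x) (gradient (φ t) x))
      + (∫ t in Ioo 0 T, ∫ x in Ω, f (H10.val (u t) x) * φ t x)
      = ∫ t in Ioo 0 T, ∫ x in Ω, g x * φ t x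

/-- The initial condition `(u, ∂ₜu)|_{t=0} = (u₀, u₁)`, understood through the representative of
`(u, ∂ₜu)` that is continuous on `[0, T]` with values in `L²(Ω) × H⁻¹(Ω)`. -/
def HasInitialData {Ω : Set E3} (T : ℝ) (u₀ : H10 Ω) (u₁ : L2 Ω)
    (u : ℝ → H10 Ω) (ut : ℝ → L2 Ω) : Prop :=
  (∃ U : ℝ → L2 Ω, ContinuousOn U (Icc 0 T) ∧
    (∀ᵐ t ∂(timeMeasure T), U t = H10.val (u t)) ∧ U 0 = H10.val u₀) ∧
  (∃ V : ℝ → Hneg1 Ω, ContinuousOn V (Icc 0 T) ∧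
    (∀ᵐ t ∂(timeMeasure T), V t = toHneg1 (ut t)) ∧ V 0 = toHneg1 u₁)

/-- Weak (energy) solutions on `[0, T]`, with `ut = ∂ₜu`:
`(u, ∂ₜu) ∈ L^∞(0, T; H¹₀(Ω) × L²(Ω))`, the equation holds in the sense of distributions and
the initial data is attained. Functions of time matter only up to null sets. -/
structure IsWeakSolution (Ω : Set E3) (T γ : ℝ) (f : ℝ → ℝ) (g : L2 Ω)
    (u₀ : H10 Ω) (u₁ : L2 Ω) (u : ℝ → H10 Ω) (ut : ℝ → L2 Ω) : Prop where
  memLp_u : MemLp u ⊤ (timeMeasure T)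
  memLp_ut : MemLp ut ⊤ (timeMeasure T)
  timeDeriv : HasWeakTimeDeriv T (fun t => H10.val (u t)) ut
  equation : SatisfiesEquation Ω T γ f g u ut
  initial : HasInitialData T u₀ u₁ u ut

instance one_le_twelve : Fact ((1 : ENNReal) ≤ 12) := ⟨by norm_num⟩

/-- Shatah–Struwe solutions: weak solutions with `u ∈ L⁴(0, T; L¹²(Ω))`. -/
structure IsShatahStruweSolution (Ω : Set E3) (T γ : ℝ) (f : ℝ → ℝ) (g : L2 Ω)
    (u₀ : H10 Ω) (u₁ : L2 Ω) (u : ℝ → H10 Ω) (ut : ℝ → L2 Ω) : Prop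
    extends IsWeakSolution Ω T γ f g u₀ u₁ u ut where
  strichartz : ∃ w : ℝ → Lp ℝ 12 (volume.restrict Ω), MemLp w 4 (timeMeasure T) ∧
    ∀ᵐ t ∂(timeMeasure T), w t =ᵐ[volume.restrict Ω] H10.val (u t)

end DampedWave

end

/-! The difference `w = u - v` has zero initial data and solves a linear wave equation with source
`h = f(u) - f(v)`. Testing with `∂ₜw` would be the natural energy argument, but `∂ₜw` lies only in
`L²`, so it is not an admissible test element. The argument therefore works one derivative lower.
The equation integrated in time, `∂ₜw + γ w - ΔW + ∫₀ᵗ h = 0` in `H⁻¹` with `W(t) = ∫₀ᵗ w`, is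
tested with `w(t)` itself, which does lie in `H¹₀`. Integrating over `(0, s)` and moving the time
integral from `h` to `w` by Fubini gives `‖w(s)‖²/2 + γ ∫₀ˢ ‖w‖² + ‖∇W(s)‖²/2 + ∫₀ˢ ⟨h(t), W(s) -
W(t)⟩ dt = 0`, which is `energy_identity`.

The source has to be controlled by the `L²` norm of `w`, the only norm of `w` in this identity.
Since `|h| ≤ K (1 + |u|⁴ + |v|⁴) |w|`, Hölder with exponents `3, 2, 6` and the Sobolev embedding of
`H¹₀` in `L⁶` give `|⟨h, ψ⟩| ≤ a(t) ‖w‖ ‖∇ψ‖` with `a = C (1 + ‖u‖⁴ + ‖v‖⁴)` and norms in `L¹²`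
(`IsNemytskii.exists_abs_sub_apply_le`). The Strichartz bound `u, v ∈ L⁴(0, T; L¹²)` says exactly
that `a` is integrable in time.

With `e² = ‖w‖² + ‖∇W‖²` this becomes `e(s)² ≤ 2 ∫₀ˢ a(t) e(t) (e(s) + e(t)) dt`, and the Gronwall
lemma `eqOn_zero_of_sq_le_integral` forces `e = 0`. The time-integrated equation, holding for almost
every `t`, comes from the distributional one by product test functions and the du Bois-Reymond
lemma. -/

noncomputable section

namespace DampedWave

open Set MeasureTheory Topology
open scoped ContDiff

/-! ### Fubini and integration by parts for vector-valued primitives -/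

section Time

theorem intervalIntegrable_bilin {X Y Z : Type*} [NormedAddCommGroup X] [NormedSpace ℝ X]
    [NormedAddCommGroup Y] [NormedSpace ℝ Y] [NormedAddCommGroup Z] [NormedSpace ℝ Z]
    (B : X →L[ℝ] Y →L[ℝ] Z) {F : ℝ → X} {g : ℝ → Y} {a b : ℝ} (hF : ContinuousOn F (uIcc a b))
    (hg : IntervalIntegrable g volume a b) :
    IntervalIntegrable (fun t => B (F t) (g t)) volume a b := by
  rw [intervalIntegrable_iff] at hg ⊢
  obtain ⟨M, hM⟩ := (isCompact_uIcc.image_of_continuousOn hF).isBounded.exists_norm_le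
  refine Integrable.mono' (hg.norm.const_mul (‖B‖ * M)) ?_ ?_
  · exact B.aestronglyMeasurable_comp₂ ((hF.mono uIoc_subset_uIcc).aestronglyMeasurable
      measurableSet_uIoc) hg.aestronglyMeasurable
  · refine (ae_restrict_mem measurableSet_uIoc).mono fun t ht => ?_
    refine (B.le_opNorm₂ _ _).trans ?_
    gcongr
    exact hM _ (mem_image_of_mem _ (uIoc_subset_uIcc ht))

variable {X Y Z : Type*} [NormedAddCommGroup X] [NormedSpace ℝ X] [CompleteSpace X]
  [NormedAddCommGroup Y] [NormedSpace ℝ Y] [CompleteSpace Y]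
  [NormedAddCommGroup Z] [NormedSpace ℝ Z] [CompleteSpace Z]

/-- Integration by parts for primitives, in the form given by Fubini's theorem. -/
theorem integral_bilin_primitive (B : X →L[ℝ] Y →L[ℝ] Z) {f : ℝ → X} {g : ℝ → Y} {s : ℝ}
    (hs : 0 ≤ s) (hf : IntervalIntegrable f volume 0 s) (hg : IntervalIntegrable g volume 0 s) :
    ∫ t in 0..s, B (∫ τ in 0..t, f τ) (g t) = ∫ t in 0..s, B (f t) (∫ τ in t..s, g τ) := by
  rw [intervalIntegrable_iff_integrableOn_Ioc_of_le hs, IntegrableOn] at hf hg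
  rw [intervalIntegral.integral_of_le hs, intervalIntegral.integral_of_le hs]
  set μ := volume.restrict (Ioc 0 s) with hμ
  -- Both sides are iterated integrals of `B (f τ) (g t)` over the triangle `τ ≤ t`.
  set k : ℝ → ℝ → Z := fun t τ => {p : ℝ × ℝ | p.2 ≤ p.1}.indicator
    (fun p => B (f p.2) (g p.1)) (t, τ) with hk
  have hint : Integrable (Function.uncurry k) (μ.prod μ) := by
    have h : Integrable (fun z : ℝ × ℝ => B (f z.1) (g z.2)) (μ.prod μ) :=
      hf.op_fst_snd (op := fun x y => B x y) B.continuous₂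
        ⟨‖B‖, fun x y => B.le_opNorm₂ x y⟩ hg
    exact h.swap.indicator (measurableSet_le measurable_snd measurable_fst)
  have h₁ : ∀ t ∈ Ioc 0 s, B (∫ τ in 0..t, f τ) (g t) = ∫ τ, k t τ ∂μ := by
    intro t ht
    have e : ∀ τ, k t τ = (B.flip (g t)) ((Iic t).indicator f τ) := by
      intro τ
      by_cases h : τ ≤ t <;> simp [hk, h]
    simp_rw [e]
    rw [ContinuousLinearMap.integral_comp_comm _ (hf.indicator measurableSet_Iic),
      integral_indicator measurableSet_Iic, hμ, Measure.restrict_restrict measurableSet_Iic,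
      intervalIntegral.integral_of_le ht.1.le]
    have : Iic t ∩ Ioc 0 s = Ioc 0 t := by
      ext x; simp only [mem_inter_iff, mem_Iic, mem_Ioc]
      exact ⟨fun h => ⟨h.2.1, h.1⟩, fun h => ⟨h.2, h.1, h.2.trans ht.2⟩⟩
    rw [this]; rfl
  have h₂ : ∀ τ ∈ Ioc 0 s, B (f τ) (∫ t in τ..s, g t) = ∫ t, k t τ ∂μ := by
    intro τ hτ
    have e : ∀ t, k t τ = (B (f τ)) ((Ici τ).indicator g t) := by
      intro t
      by_cases h : τ ≤ t <;> simp [hk, h]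
    simp_rw [e]
    rw [ContinuousLinearMap.integral_comp_comm _ (hg.indicator measurableSet_Ici),
      integral_indicator measurableSet_Ici, hμ, Measure.restrict_restrict measurableSet_Ici,
      intervalIntegral.integral_of_le hτ.2, ← integral_Icc_eq_integral_Ioc]
    -- The slice of the triangle at `τ` is closed at its left end, hence the passage from `Ioc` to
    -- `Icc` above.
    have : Ici τ ∩ Ioc 0 s = Icc τ s := by
      ext x; simp only [mem_inter_iff, mem_Ici, mem_Ioc, mem_Icc]
      exact ⟨fun h => ⟨h.1, h.2.2⟩, fun h => ⟨h.1, hτ.1.trans_le h.1, h.2⟩⟩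
    rw [this]
  rw [setIntegral_congr_fun measurableSet_Ioc h₁, setIntegral_congr_fun measurableSet_Ioc h₂]
  exact integral_integral_swap hint

/-- The derivative formula `B (F s) (F s) = 2 ∫₀ˢ B (F, F')` for symmetric `B`
and `F = ∫₀ f`. -/
theorem bilin_primitive_self (B : X →L[ℝ] X →L[ℝ] Z) (hB : ∀ x y, B x y = B y x)
    {f : ℝ → X} {s : ℝ} (hs : 0 ≤ s) (hf : IntervalIntegrable f volume 0 s) :
    B (∫ t in 0..s, f t) (∫ t in 0..s, f t) = (2 : ℝ) • ∫ t in 0..s, B (∫ τ in 0..t, f τ) (f t) := by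
  have h := integral_bilin_primitive B hs hf hf
  -- Write `F(t) = ∫₀ᵗ f` and `I = ∫₀ˢ B (F, f)`. Since `∫ₜˢ f = F(s) - F(t)`, symmetry turns the
  -- Fubini identity into `I = B (F s) (F s) - I`.
  have hsub : ∀ t ∈ uIcc 0 s, B (f t) (∫ τ in t..s, f τ)
      = B (∫ t in 0..s, f t) (f t) - B (∫ τ in 0..t, f τ) (f t) := by
    intro t ht
    have h1 : IntervalIntegrable f volume 0 t := hf.mono_set (uIcc_subset_uIcc_left ht)
    rw [← intervalIntegral.integral_interval_sub_left hf h1, map_sub, hB (f t), hB (f t)]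
  have hcont : ContinuousOn (fun t => ∫ τ in 0..t, f τ) (uIcc 0 s) :=
    intervalIntegral.continuousOn_primitive_interval' hf left_mem_uIcc
  have hi : IntervalIntegrable (fun t => B (∫ τ in 0..t, f τ) (f t)) volume 0 s :=
    intervalIntegrable_bilin B hcont hf
  have hi' : IntervalIntegrable (fun t => B (∫ t in 0..s, f t) (f t)) volume 0 s := by
    rw [intervalIntegrable_iff] at hf ⊢
    exact ContinuousLinearMap.integrable_comp _ hf
  rw [intervalIntegral.integral_congr hsub, intervalIntegral.integral_sub hi' hi,
    ContinuousLinearMap.intervalIntegral_comp_comm _ hf] at h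
  rw [two_smul]
  nth_rewrite 1 [h]
  simp

theorem exists_Icc_of_compact_subset_Ioo {T : ℝ} (hT : 0 < T) {K : Set ℝ} (hK : IsCompact K)
    (h : K ⊆ Ioo 0 T) : ∃ a b, 0 < a ∧ a < b ∧ b < T ∧ K ⊆ Icc a b := by
  rcases K.eq_empty_or_nonempty with rfl | hne
  · exact ⟨T / 3, T / 2, by positivity, by linarith, by linarith, by simp⟩
  · obtain ⟨a, ha, ha'⟩ := hK.exists_isLeast hne
    obtain ⟨b, hb, hb'⟩ := hK.exists_isGreatest hne
    have h1 := h ha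
    have h2 := h hb
    -- Halving the minimum keeps the interval nondegenerate when `K` is a single point.
    exact ⟨a / 2, b, by linarith [h1.1], by linarith [h1.1, ha' hb], h2.2,
      fun x hx => ⟨by linarith [h1.1, ha' hx], hb' hx⟩⟩

end Time

/-! ### Weak derivatives in time and the du Bois-Reymond lemma -/

section WeakDeriv

variable {X : Type*} [NormedAddCommGroup X] [NormedSpace ℝ X] [CompleteSpace X]

theorem IsTestFunction.continuous {η : ℝ → ℝ} {W : Set ℝ} (h : IsTestFunction W η) :
    Continuous η := h.smooth.continuous

theorem IsTestFunction.eq_zero {η : ℝ → ℝ} {W : Set ℝ} (h : IsTestFunction W η) {t : ℝ}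
    (ht : t ∉ W) : η t = 0 :=
  image_eq_zero_of_notMem_tsupport fun h' => ht (h.support_subset h')

theorem IsTestFunction.continuous_deriv {η : ℝ → ℝ} {W : Set ℝ} (h : IsTestFunction W η) :
    Continuous (deriv η) := h.smooth.continuous_deriv (by simp)

theorem IsTestFunction.integral_deriv {η : ℝ → ℝ} {W : Set ℝ} (h : IsTestFunction W η) (a b : ℝ) :
    ∫ t in a..b, deriv η t = η b - η a :=
  intervalIntegral.integral_deriv_eq_sub
    (fun x _ => (h.smooth.differentiable (by simp)) x) (h.continuous_deriv.intervalIntegrable _ _)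

/-- A test function of zero mean is the derivative of a test function. -/
theorem IsTestFunction.exists_primitive {T : ℝ} (hT : 0 < T) {ξ : ℝ → ℝ}
    (h : IsTestFunction (Ioo 0 T) ξ) (h0 : ∫ t in 0..T, ξ t = 0) :
    ∃ ζ, IsTestFunction (Ioo 0 T) ζ ∧ deriv ζ = ξ := by
  obtain ⟨a, b, ha, hab, hb, hK⟩ := exists_Icc_of_compact_subset_Ioo hT h.compact h.support_subset
  have hξ : ∀ t, t ∉ Icc a b → ξ t = 0 := fun t ht =>
    image_eq_zero_of_notMem_tsupport fun h' => ht (hK h')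
  have hi : ∀ a b, IntervalIntegrable ξ volume a b := fun a b => h.continuous.intervalIntegrable a b
  set ζ : ℝ → ℝ := fun t => ∫ τ in 0..t, ξ τ with hζ
  have hder : deriv ζ = ξ := by
    funext t
    exact h.continuous.deriv_integral ξ 0 t
  have hsm : ContDiff ℝ ∞ ζ := by
    rw [contDiff_infty_iff_deriv, hder]
    exact ⟨fun t => (intervalIntegral.integral_hasDerivAt_right (hi _ _)
      (h.continuous.stronglyMeasurableAtFilter _ _) h.continuous.continuousAt).differentiableAt,
      h.smooth⟩
  have hsupp : Function.support ζ ⊆ Icc a b := by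
    intro t ht
    by_contra hc
    apply ht
    rcases lt_or_ge t a with hta | hta
    · refine (intervalIntegral.integral_congr (g := fun _ => (0 : ℝ)) fun τ hτ => ?_).trans (by simp)
      refine hξ τ fun h' => ?_
      have : τ < a := by
        rcases mem_uIcc.1 hτ with h | h
        · linarith [h.2]
        · linarith [h.2]
      linarith [h'.1]
    · have htb : b < t := by
        by_contra h'
        exact hc ⟨hta, not_lt.1 h'⟩
      -- To the right of `b` the primitive splits as `∫₀ᵀ ξ + ∫_Tᵗ ξ`: the first term is the zero
      -- mean, and the second avoids the support of `ξ`.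
      have h1 : ∫ τ in T..t, ξ τ = 0 := by
        refine (intervalIntegral.integral_congr (g := fun _ => (0 : ℝ)) fun τ hτ => ?_).trans
          (by simp)
        refine hξ τ fun h' => ?_
        have : b < τ := by
          rcases mem_uIcc.1 hτ with h | h
          · linarith [h.1]
          · linarith [h.1]
        linarith [h'.2]
      simp only [hζ]
      rw [← intervalIntegral.integral_add_adjacent_intervals (hi 0 T) (hi T t), h0, h1, add_zero]
  have hts : tsupport ζ ⊆ Icc a b := closure_minimal hsupp isClosed_Icc
  exact ⟨ζ, ⟨hsm, isCompact_Icc.of_isClosed_subset (isClosed_tsupport _) hts,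
    hts.trans (Icc_subset_Ioo ha hb)⟩, hder⟩

theorem exists_testFunction_integral_one {T : ℝ} (hT : 0 < T) :
    ∃ η, IsTestFunction (Ioo 0 T) η ∧ ∫ t in 0..T, η t = 1 := by
  let φ : ContDiffBump (T / 2) := ⟨T / 8, T / 4, by positivity, by linarith⟩
  have hsub : tsupport (φ.normed volume) ⊆ Ioo 0 T := by
    rw [φ.tsupport_normed_eq, Real.closedBall_eq_Icc]
    intro x hx
    have h1 : T / 2 - T / 4 ≤ x := hx.1
    have h2 : x ≤ T / 2 + T / 4 := hx.2
    exact ⟨by linarith, by linarith⟩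
  refine ⟨φ.normed volume, ⟨φ.contDiff_normed, φ.hasCompactSupport_normed, hsub⟩, ?_⟩
  rw [intervalIntegral.integral_of_le hT.le, setIntegral_eq_integral_of_forall_compl_eq_zero]
  · exact φ.integral_normed
  · intro x hx
    exact image_eq_zero_of_notMem_tsupport fun h => hx (Ioo_subset_Ioc_self (hsub h))

theorem ae_eq_zero_of_integral_testFunction_smul {T : ℝ} (hT : 0 < T) {G : ℝ → X}
    (hG : IntervalIntegrable G volume 0 T)
    (h : ∀ η, IsTestFunction (Ioo 0 T) η → ∫ t in 0..T, η t • G t = 0) :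
    ∀ᵐ t ∂(timeMeasure T), G t = 0 := by
  rw [intervalIntegrable_iff_integrableOn_Ioo_of_le hT.le] at hG
  rw [ae_restrict_iff' measurableSet_Ioo]
  refine isOpen_Ioo.ae_eq_zero_of_integral_contDiff_smul_eq_zero hG.locallyIntegrableOn ?_
  intro η h1 h2 h3
  have h' := h η ⟨h1, h2, h3⟩
  rw [intervalIntegral.integral_of_le hT.le, setIntegral_eq_integral_of_forall_compl_eq_zero] at h'
  · exact h'
  · intro x hx
    have : η x = 0 :=
      image_eq_zero_of_notMem_tsupport fun h => hx (Ioo_subset_Ioc_self (h3 h))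
    simp [this]

/-- Fubini moves the integral from `G` to `deriv η`, and `∫ₜᵀ deriv η = -η t` because `η` vanishes
at `T`. -/
theorem integral_deriv_smul_primitive {T : ℝ} (hT : 0 < T) {G : ℝ → X}
    (hG : IntervalIntegrable G volume 0 T) {η : ℝ → ℝ} (hη : IsTestFunction (Ioo 0 T) η) :
    ∫ t in 0..T, deriv η t • ∫ τ in 0..t, G τ = -∫ t in 0..T, η t • G t := by
  have h := integral_bilin_primitive (ContinuousLinearMap.lsmul ℝ ℝ : ℝ →L[ℝ] X →L[ℝ] X).flip
    hT.le hG (hη.continuous_deriv.intervalIntegrable 0 T)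
  simp only [ContinuousLinearMap.flip_apply, ContinuousLinearMap.lsmul_apply,
    hη.integral_deriv, hη.eq_zero (t := T) (by simp), zero_sub, neg_smul,
    intervalIntegral.integral_neg] at h
  exact h

/-- The du Bois-Reymond lemma, for a continuous function with an integrable weak derivative. -/
theorem eq_add_primitive_of_weakDeriv {T : ℝ} (hT : 0 < T) {F G : ℝ → X}
    (hF : ContinuousOn F (Icc 0 T)) (hG : IntervalIntegrable G volume 0 T)
    (h : ∀ η, IsTestFunction (Ioo 0 T) η →
      ∫ t in 0..T, deriv η t • F t = -∫ t in 0..T, η t • G t) :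
    ∀ t ∈ Icc 0 T, F t = F 0 + ∫ τ in 0..t, G τ := by
  have hP : ContinuousOn (fun t => ∫ τ in 0..t, G τ) (Icc 0 T) := by
    rw [← uIcc_of_le hT.le]
    exact intervalIntegral.continuousOn_primitive_interval' hG left_mem_uIcc
  set K : ℝ → X := fun t => F t - ∫ τ in 0..t, G τ with hK
  have hKc : ContinuousOn K (Icc 0 T) := hF.sub hP
  have hFi : IntervalIntegrable F volume 0 T := hF.intervalIntegrable_of_Icc hT.le
  have hPi := hP.intervalIntegrable_of_Icc (μ := volume) hT.le
  have hKi : IntervalIntegrable K volume 0 T := hKc.intervalIntegrable_of_Icc hT.le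
  have hK0 : ∀ ζ, IsTestFunction (Ioo 0 T) ζ → ∫ t in 0..T, deriv ζ t • K t = 0 := by
    intro ζ hζ
    simp only [hK, smul_sub]
    rw [intervalIntegral.integral_sub
      (hFi.continuousOn_smul hζ.continuous_deriv.continuousOn)
      (hPi.continuousOn_smul hζ.continuous_deriv.continuousOn), h ζ hζ,
      integral_deriv_smul_primitive hT hG hζ, sub_self]
  obtain ⟨η₀, hη₀, hη₀1⟩ := exists_testFunction_integral_one hT
  -- `K` has zero weak derivative, so it must be constant. As `η₀` has mean one, the constant is its
  -- pairing with `K`.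
  set c : X := ∫ t in 0..T, η₀ t • K t with hc
  have hae : ∀ᵐ t ∂(timeMeasure T), K t - c = 0 := by
    refine ae_eq_zero_of_integral_testFunction_smul hT
      (hKi.sub (intervalIntegrable_const (c := c))) fun θ hθ => ?_
    set m := ∫ t in 0..T, θ t with hm
    -- Removing the mean of `θ` with a multiple of `η₀` leaves the derivative of a test function,
    -- against which `K` integrates to zero.
    have hξ : IsTestFunction (Ioo 0 T) (fun t => θ t - m * η₀ t) := by
      refine ⟨hθ.smooth.sub (contDiff_const.mul hη₀.smooth),
        hθ.compact.sub (hη₀.compact.mul_left (f := fun _ => m)), ?_⟩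
      refine (tsupport_sub _ _).trans (union_subset hθ.support_subset ?_)
      exact (tsupport_mul_subset_right (f := fun _ => m) (g := η₀)).trans hη₀.support_subset
    obtain ⟨ζ, hζ, hζ'⟩ := hξ.exists_primitive hT (by
      rw [intervalIntegral.integral_sub (hθ.continuous.intervalIntegrable _ _)
        ((hη₀.continuous.intervalIntegrable _ _).const_mul m),
        intervalIntegral.integral_const_mul, hη₀1, mul_one, sub_self])
    have h1 := hK0 ζ hζ
    simp only [hζ', sub_smul, mul_smul] at h1
    rw [intervalIntegral.integral_sub (hKi.continuousOn_smul hθ.continuous.continuousOn)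
      ((hKi.continuousOn_smul hη₀.continuous.continuousOn).continuousOn_smul continuousOn_const),
      intervalIntegral.integral_smul, ← hc] at h1
    simp only [smul_sub]
    rw [intervalIntegral.integral_sub (hKi.continuousOn_smul hθ.continuous.continuousOn)
      (intervalIntegrable_const.continuousOn_smul hθ.continuous.continuousOn),
      intervalIntegral.integral_smul_const, ← hm, h1]
  -- Continuity upgrades the equality from almost every time to all of `[0, T]`, so the constant can
  -- be read off at `t = 0`.
  have hEq : EqOn K (fun _ => c) (Icc 0 T) := by
    refine Measure.eqOn_Icc_of_ae_eq volume hT.ne ?_ hKc continuousOn_const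
    rw [← restrict_Ioo_eq_restrict_Icc]
    exact hae.mono fun t ht => sub_eq_zero.1 ht
  intro t ht
  have h1 : F t - ∫ τ in 0..t, G τ = c := hEq ht
  have h2 : F 0 - ∫ τ in 0..0, G τ = c := hEq (left_mem_Icc.2 hT.le)
  rw [intervalIntegral.integral_same, sub_zero] at h2
  rw [h2, ← h1, sub_add_cancel]

theorem ae_eq_zero_of_primitive_eq_zero {T : ℝ} (hT : 0 < T) {G : ℝ → X}
    (hG : IntervalIntegrable G volume 0 T) (h : ∀ t ∈ Icc 0 T, ∫ τ in 0..t, G τ = 0) :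
    ∀ᵐ t ∂(timeMeasure T), G t = 0 := by
  refine ae_eq_zero_of_integral_testFunction_smul hT hG fun η hη => ?_
  have h1 := integral_deriv_smul_primitive hT hG hη
  rw [intervalIntegral.integral_congr (g := fun _ => (0 : X)) (fun t ht => by
    rw [uIcc_of_le hT.le] at ht
    simp only [h t ht, smul_zero])] at h1
  simpa using h1.symm

end WeakDeriv

/-- A Gronwall lemma with an integrable kernel. -/
theorem eqOn_zero_of_sq_le_integral {T : ℝ} {a e : ℝ → ℝ}
    (ha : IntervalIntegrable a volume 0 T) (ha0 : ∀ t, 0 ≤ a t)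
    (he : ContinuousOn e (Icc 0 T)) (he0 : ∀ t, 0 ≤ e t)
    (h : ∀ s ∈ Icc 0 T, e s ^ 2 ≤ ∫ t in 0..s, a t * (e t * (e s + e t))) :
    ∀ t ∈ Icc 0 T, e t = 0 := by
  rcases lt_or_ge T 0 with hT | hT
  · intro t ht
    exact absurd (ht.1.trans ht.2) (not_le.2 hT)
  have hcl : IsClosed ({t | e t = 0} ∩ Icc 0 T) := by
    rw [inter_comm]
    exact he.preimage_isClosed_of_isClosed isClosed_Icc isClosed_singleton
  -- Continuous induction: the zero set of `e` is closed and contains `0`, so it suffices to extend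
  -- it slightly to the right of any `t` up to which `e` vanishes.
  refine hcl.Icc_subset_of_forall_mem_nhdsGT_of_Icc_subset ?_ ?_
  · have := h 0 (left_mem_Icc.2 hT)
    simp only [intervalIntegral.integral_same] at this
    exact pow_eq_zero_iff two_ne_zero |>.1 (le_antisymm this (sq_nonneg _))
  · intro t ht hzero
    have hP : ContinuousOn (fun s => ∫ τ in 0..s, a τ) (Icc 0 T) := by
      rw [← uIcc_of_le hT]
      exact intervalIntegral.continuousOn_primitive_interval' ha left_mem_uIcc
    have hsubi : ∀ {x y}, x ∈ Icc 0 T → y ∈ Icc 0 T → IntervalIntegrable a volume x y := by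
      intro x y hx hy
      refine ha.mono_set ?_
      rw [uIcc_of_le hT]
      exact uIcc_subset_Icc hx hy
    have htI : t ∈ Icc 0 T := ⟨ht.1, ht.2.le⟩
    -- With mass of `a` below `1 / 4` on `[t, r]`, the hypothesis at a maximum point `s` of `e` on
    -- `[t, r]` gives `e(s)² ≤ 2 e(s)² ∫ a ≤ e(s)² / 2`, hence `e(s) = 0`.
    have hev : ∀ᶠ s in 𝓝[>] t, s ∈ Ioc t T ∧ ∫ τ in t..s, a τ < 1 / 4 := by
      have h1 : ∀ᶠ s in 𝓝[>] t, s ∈ Ioc t T := Ioc_mem_nhdsGT ht.2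
      have h2 : Filter.Tendsto (fun s => ∫ τ in 0..s, a τ) (𝓝[>] t) (𝓝 (∫ τ in 0..t, a τ)) :=
        ((hP t htI).mono_left (nhdsWithin_le_of_mem (Filter.mem_of_superset h1
          fun s hs => ⟨ht.1.trans hs.1.le, hs.2⟩)))
      have h3 := h2.eventually_lt_const
        (lt_add_of_pos_right (∫ τ in 0..t, a τ) (by norm_num : (0 : ℝ) < 1 / 4))
      filter_upwards [h1, h3] with s hs hs'
      refine ⟨hs, ?_⟩
      have hsI : s ∈ Icc 0 T := ⟨ht.1.trans hs.1.le, hs.2⟩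
      rw [← intervalIntegral.integral_interval_sub_left (hsubi (left_mem_Icc.2 hT) hsI)
        (hsubi (left_mem_Icc.2 hT) htI)]
      linarith
    filter_upwards [hev] with r hr
    obtain ⟨hr1, hr2⟩ := hr
    have hrI : Icc t r ⊆ Icc 0 T := Icc_subset_Icc ht.1 hr1.2
    obtain ⟨s, hs, hmax⟩ := isCompact_Icc.exists_isMaxOn (nonempty_Icc.2 hr1.1.le) (he.mono hrI)
    have hle : e s ^ 2 ≤ ∫ τ in t..s, a τ * (2 * e s ^ 2) := by
      have hcont : ContinuousOn (fun τ => e τ * (e s + e τ)) (Icc 0 T) :=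
        he.mul (continuousOn_const.add he)
      have hi : ∀ {x y}, x ∈ Icc 0 T → y ∈ Icc 0 T →
          IntervalIntegrable (fun τ => a τ * (e τ * (e s + e τ))) volume x y := fun hx hy =>
        (hsubi hx hy).mul_continuousOn (hcont.mono (uIcc_subset_Icc hx hy))
      have hz : ∫ τ in 0..t, a τ * (e τ * (e s + e τ)) = 0 := by
        refine (intervalIntegral.integral_congr (g := fun _ => (0 : ℝ)) fun τ hτ => ?_).trans
          (by simp)
        rw [uIcc_of_le ht.1] at hτ
        have : e τ = 0 := hzero hτ
        simp [this]
      refine (h s (hrI hs)).trans ?_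
      rw [← intervalIntegral.integral_add_adjacent_intervals
        (hi (left_mem_Icc.2 hT) htI) (hi htI (hrI hs)), hz, zero_add]
      refine intervalIntegral.integral_mono_on hs.1 (hi htI (hrI hs))
        ((hsubi htI (hrI hs)).mul_const _) fun τ hτ => ?_
      refine mul_le_mul_of_nonneg_left ?_ (ha0 τ)
      have hm : e τ ≤ e s := hmax ⟨hτ.1, hτ.2.trans hs.2⟩
      nlinarith [he0 τ, he0 s]
    rw [intervalIntegral.integral_mul_const] at hle
    have hmono : ∫ τ in t..s, a τ ≤ ∫ τ in t..r, a τ :=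
      intervalIntegral.integral_mono_interval le_rfl hs.1 hs.2
        (Filter.Eventually.of_forall ha0) (hsubi htI (hrI (right_mem_Icc.2 hr1.1.le)))
    have hes : e s ^ 2 ≤ 0 := by nlinarith [sq_nonneg (e s)]
    have hes0 : e s = 0 := pow_eq_zero_iff two_ne_zero |>.1 (le_antisymm hes (sq_nonneg _))
    have : e r ≤ e s := hmax (right_mem_Icc.2 hr1.1.le)
    exact le_antisymm (this.trans hes0.le) (he0 r)

/-! ### The Sobolev embedding of `H¹₀(Ω)` in `L⁶(Ω)` -/

section Sobolev

open scoped NNReal ENNReal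

theorem norm_gradient_eq (φ : E3 → ℝ) (x : E3) : ‖gradient φ x‖ = ‖fderiv ℝ φ x‖ := by
  simp [gradient]

theorem support_gradient_subset (φ : E3 → ℝ) : Function.support (gradient φ) ⊆ tsupport φ := by
  intro x hx
  refine support_fderiv_subset ℝ ?_
  intro h
  exact hx (by simp [gradient, h])

/-- The Sobolev inequality `‖φ‖_{L⁶} ≤ S ‖∇φ‖_{L²}` for test functions. -/
theorem IsTestFunction.eLpNorm_six_le {Ω : Set E3} {φ : E3 → ℝ} (h : IsTestFunction Ω φ) :
    eLpNorm φ 6 (volume.restrict Ω) ≤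
      SNormLESNormFDerivOfEqConst ℝ (volume : Measure E3) 2 *
        eLpNorm (gradient φ) 2 (volume.restrict Ω) := by
  have h1 := eLpNorm_le_eLpNorm_fderiv_of_eq (F := ℝ) (volume : Measure E3) (u := φ) (p := 2)
    (p' := 6) (h.smooth.of_le (by simp)) h.compact (by norm_num) (by simp) (by simp; norm_num)
  rw [eLpNorm_restrict_eq_of_support_subset ((subset_tsupport φ).trans h.support_subset),
    eLpNorm_restrict_eq_of_support_subset
      ((support_gradient_subset φ).trans h.support_subset),
    eLpNorm_congr_norm_ae (g := fderiv ℝ φ) (Filter.Eventually.of_forall (norm_gradient_eq φ))]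
  exact_mod_cast h1

/-- The Sobolev inequality on `H¹₀(Ω)`. -/
theorem H10.eLpNorm_six_le {Ω : Set E3} (p : H10 Ω) :
    eLpNorm (H10.val p) 6 (volume.restrict Ω) ≤
      SNormLESNormFDerivOfEqConst ℝ (volume : Measure E3) 2 * ‖H10.grad p‖ₑ := by
  obtain ⟨x, hx, hlim⟩ := mem_closure_iff_seq_limit.1 p.2
  have hfst : Filter.Tendsto (fun n => (x n).fst) Filter.atTop (𝓝 (H10.val p)) :=
    ((WithLp.fstL 2 ℝ (L2 Ω) (L2vec Ω)).continuous.tendsto _).comp hlim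
  have hsnd : Filter.Tendsto (fun n => (x n).snd) Filter.atTop (𝓝 (H10.grad p)) :=
    ((WithLp.sndL 2 ℝ (L2 Ω) (L2vec Ω)).continuous.tendsto _).comp hlim
  have hn : ∀ n, eLpNorm (x n).fst 6 (volume.restrict Ω) ≤
      SNormLESNormFDerivOfEqConst ℝ (volume : Measure E3) 2 * ‖(x n).snd‖ₑ := by
    intro n
    obtain ⟨φ, hφ, h1, h2⟩ := hx n
    rw [eLpNorm_congr_ae h1, Lp.enorm_def, eLpNorm_congr_ae h2]
    exact hφ.eLpNorm_six_le
  have hlim2 : Filter.Tendsto (fun n =>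
      (SNormLESNormFDerivOfEqConst ℝ (volume : Measure E3) 2 : ℝ≥0∞) * ‖(x n).snd‖ₑ) Filter.atTop
      (𝓝 (SNormLESNormFDerivOfEqConst ℝ (volume : Measure E3) 2 * ‖H10.grad p‖ₑ)) :=
    ENNReal.Tendsto.const_mul (hsnd.enorm) (Or.inr ENNReal.coe_ne_top)
  refine le_of_forall_gt_imp_ge_of_dense fun c hc => ?_
  -- Convergence in `L²` implies convergence in measure, and bounds on the `L⁶` norm survive limits
  -- in measure.
  refine eLpNorm_le_of_tendstoInMeasure (u := Filter.atTop) (f := fun n => ((x n).fst : E3 → ℝ))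
    ?_ (tendstoInMeasure_of_tendsto_Lp hfst) (fun n => Lp.aestronglyMeasurable _)
  filter_upwards [hlim2.eventually_lt_const hc] with n h
  exact (hn n).trans h.le

theorem H10.norm_grad_le {Ω : Set E3} (p : H10 Ω) : ‖H10.grad p‖ ≤ ‖p‖ :=
  WithLp.norm_snd_le _ (p : WithLp 2 (L2 Ω × L2vec Ω))

end Sobolev

/-! ### Pointwise and Hölder estimates for the quintic nonlinearity -/

section Nonlinear

open scoped NNReal ENNReal

/-- Mean value inequality on the segment from `b` to `a`, where `|x|` is at most the larger of `|a|`
and `|b|`. The growth bound at `0` shows `C ≥ 0`. -/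
theorem QuinticGrowth.exists_lipschitz {f : ℝ → ℝ} (hf : QuinticGrowth f) :
    ∃ K : ℝ, 0 ≤ K ∧ ∀ a b, |f a - f b| ≤ K * (1 + |a| ^ 4 + |b| ^ 4) * |a - b| := by
  obtain ⟨C, hC⟩ := hf.bound
  have hC0 : 0 ≤ C := by
    have := (abs_nonneg _).trans (hC 0)
    simpa using this
  refine ⟨C, hC0, fun a b => ?_⟩
  have hd : Differentiable ℝ f := hf.contDiff.differentiable (by simp)
  have := (convex_segment (𝕜 := ℝ) b a).norm_image_sub_le_of_norm_deriv_le (f := f)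
    (C := C * (1 + |a| ^ 4 + |b| ^ 4)) (fun x _ => hd x) (fun x hx => ?_)
    (left_mem_segment ℝ b a) (right_mem_segment ℝ b a)
  · simpa only [Real.norm_eq_abs] using this
  · rw [Real.norm_eq_abs]
    refine (hC x).trans (mul_le_mul_of_nonneg_left ?_ hC0)
    rw [segment_eq_uIcc] at hx
    have hx' : |x| ≤ max |b| |a| := by
      rcases mem_uIcc.1 hx with h | h
      · exact abs_le_max_abs_abs h.1 h.2
      · rw [max_comm]
        exact abs_le_max_abs_abs h.1 h.2
    have : |x| ^ 4 ≤ |a| ^ 4 + |b| ^ 4 := by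
        rcases le_max_iff.1 hx' with h | h
        · have := pow_le_pow_left₀ (abs_nonneg x) h 4
          have : 0 ≤ |a| ^ 4 := by positivity
          linarith
        · have := pow_le_pow_left₀ (abs_nonneg x) h 4
          have : 0 ≤ |b| ^ 4 := by positivity
          linarith
    linarith

variable {α : Type*} [MeasurableSpace α] {μ : Measure α}

/-- Hölder's inequality applied to a difference `f(u) - f(v)` of quintic nonlinearities. -/
theorem eLpNorm_nonlinear_sub_mul_le {f : ℝ → ℝ} {K : ℝ}
    (hK : ∀ a b, |f a - f b| ≤ K * (1 + |a| ^ 4 + |b| ^ 4) * |a - b|)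
    {q r s t : ℝ≥0∞} (hq : 1 ≤ q) [ENNReal.HolderTriple q r s] [ENNReal.HolderTriple s t 1]
    {u v ψ : α → ℝ} (hu : AEStronglyMeasurable u μ) (hv : AEStronglyMeasurable v μ)
    (hψ : AEStronglyMeasurable ψ μ) :
    eLpNorm (fun x => (f (u x) - f (v x)) * ψ x) 1 μ ≤
      ENNReal.ofReal K * (eLpNorm (fun _ => (1 : ℝ)) q μ + eLpNorm u (q * 4) μ ^ 4
        + eLpNorm v (q * 4) μ ^ 4) * eLpNorm (fun x => u x - v x) r μ * eLpNorm ψ t μ := by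
  have h4 : ∀ w : α → ℝ, eLpNorm (fun x => |w x| ^ 4) q μ = eLpNorm w (q * 4) μ ^ 4 := by
    intro w
    have := eLpNorm_norm_rpow (μ := μ) (p := q) w (q := 4) (by norm_num)
    have e : ENNReal.ofReal 4 = 4 := by norm_num
    rw [e, show (4 : ℝ) = ((4 : ℕ) : ℝ) by norm_num, ENNReal.rpow_natCast] at this
    simpa only [Real.rpow_natCast, Real.norm_eq_abs] using this
  have hm4 : ∀ {w : α → ℝ}, AEStronglyMeasurable w μ →
      AEStronglyMeasurable (fun x => |w x| ^ 4) μ := fun hw => hw.norm.pow 4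
  set a : α → ℝ := fun x => 1 + |u x| ^ 4 + |v x| ^ 4 with ha
  have ham : AEStronglyMeasurable a μ := (aestronglyMeasurable_const.add (hm4 hu)).add (hm4 hv)
  have hbm : AEStronglyMeasurable (fun x => u x - v x) μ := hu.sub hv
  have hna : eLpNorm a q μ ≤ eLpNorm (fun _ => (1 : ℝ)) q μ + eLpNorm u (q * 4) μ ^ 4
      + eLpNorm v (q * 4) μ ^ 4 := by
    rw [← h4, ← h4]
    refine (eLpNorm_add_le (aestronglyMeasurable_const.add (hm4 hu)) (hm4 hv) hq).trans ?_
    gcongr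
    exact eLpNorm_add_le aestronglyMeasurable_const (hm4 hu) hq
  have hab : eLpNorm (fun x => a x * (u x - v x)) s μ ≤
      eLpNorm a q μ * eLpNorm (fun x => u x - v x) r μ := by
    simpa using! eLpNorm_smul_le_mul_eLpNorm hbm ham (r := s)
  have habψ : eLpNorm (fun x => a x * (u x - v x) * ψ x) 1 μ ≤
      eLpNorm (fun x => a x * (u x - v x)) s μ * eLpNorm ψ t μ := by
    simpa using! eLpNorm_smul_le_mul_eLpNorm hψ (ham.mul hbm) (r := 1)
  have hpt : eLpNorm (fun x => (f (u x) - f (v x)) * ψ x) 1 μ ≤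
      ENNReal.ofReal K * eLpNorm (fun x => a x * (u x - v x) * ψ x) 1 μ := by
    refine (eLpNorm_le_mul_eLpNorm_of_ae_le_mul (Filter.Eventually.of_forall fun x => ?_) 1)
    have hax : |a x| = a x := abs_of_nonneg (by simp only [ha]; positivity)
    rw [norm_mul, norm_mul, norm_mul, Real.norm_eq_abs, Real.norm_eq_abs, Real.norm_eq_abs, hax,
      ← mul_assoc, ← mul_assoc]
    exact mul_le_mul_of_nonneg_right (hK _ _) (abs_nonneg _)
  calc _ ≤ _ := hpt
    _ ≤ ENNReal.ofReal K * (eLpNorm a q μ * eLpNorm (fun x => u x - v x) r μ * eLpNorm ψ t μ) := by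
      gcongr
      exact habψ.trans (by gcongr)
    _ ≤ _ := by
      rw [← mul_assoc, ← mul_assoc]
      gcongr

end Nonlinear

/-! ### The map `p ↦ f(p)` from `H¹₀(Ω)` to `H⁻¹(Ω)` -/

section Nemytskii

open scoped NNReal ENNReal

theorem holderTriple_of_toReal {p q r : ℝ≥0∞} (hp : p ≠ 0) (hq : q ≠ 0) (hr : r ≠ 0)
    (h : p.toReal⁻¹ + q.toReal⁻¹ = r.toReal⁻¹) : ENNReal.HolderTriple p q r := by
  refine ⟨?_⟩
  rw [← ENNReal.toReal_eq_toReal_iff' (ENNReal.add_ne_top.2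
    ⟨ENNReal.inv_ne_top.2 hp, ENNReal.inv_ne_top.2 hq⟩) (ENNReal.inv_ne_top.2 hr),
    ENNReal.toReal_add (ENNReal.inv_ne_top.2 hp) (ENNReal.inv_ne_top.2 hq)]
  simpa only [ENNReal.toReal_inv] using h

/-- Two ways to place `|u|⁴ |u - v|` in `L^(6/5)`, the dual of `L⁶`: for `u ∈ L¹²`, `|u|⁴ ∈ L³` and
the difference is taken in `L²`; for `u ∈ L⁶`, `|u|⁴ ∈ L^(3/2)` and the difference is taken in `L⁶`.
-/
instance holderTriple_three_two : ENNReal.HolderTriple 3 2 (6 / 5) :=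
  holderTriple_of_toReal (by simp) (by simp) (by simp) (by norm_num)

instance holderTriple_three_halves_six : ENNReal.HolderTriple (3 / 2) 6 (6 / 5) :=
  holderTriple_of_toReal (by simp) (by simp) (by simp) (by norm_num)

instance holderTriple_six_fifths_six : ENNReal.HolderTriple (6 / 5) 6 1 :=
  holderTriple_of_toReal (by simp) (by simp) (by simp) (by norm_num)

theorem one_le_three_halves : (1 : ℝ≥0∞) ≤ 3 / 2 := by
  rw [ENNReal.le_div_iff_mul_le (by simp) (by simp)]
  norm_num

theorem three_halves_mul_four : (3 / 2 * 4 : ℝ≥0∞) = 6 := by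
  rw [← ENNReal.toReal_eq_toReal_iff' (ENNReal.mul_ne_top (ENNReal.div_ne_top (by simp) (by simp))
    (by simp)) (by simp)]
  norm_num

variable {Ω : Set E3}

theorem H10.memLp_six (p : H10 Ω) : MemLp (H10.val p) 6 (volume.restrict Ω) :=
  ⟨Lp.aestronglyMeasurable _, (H10.eLpNorm_six_le p).trans_lt
    (ENNReal.mul_lt_top ENNReal.coe_lt_top enorm_lt_top)⟩

theorem H10.exists_eLpNorm_six_le (Ω : Set E3) : ∃ S : ℝ, 0 ≤ S ∧ ∀ p : H10 Ω,
    (eLpNorm (H10.val p) 6 (volume.restrict Ω)).toReal ≤ S * ‖H10.grad p‖ := by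
  refine ⟨SNormLESNormFDerivOfEqConst ℝ (volume : Measure E3) 2, NNReal.coe_nonneg _, fun p => ?_⟩
  have := ENNReal.toReal_mono (ENNReal.mul_lt_top ENNReal.coe_lt_top enorm_lt_top).ne
    (H10.eLpNorm_six_le p)
  simpa using this

theorem integrable_nonlinear_sub_mul [IsFiniteMeasure (volume.restrict Ω)] {f : ℝ → ℝ} {K : ℝ}
    (hf : Continuous f) (hK : ∀ a b, |f a - f b| ≤ K * (1 + |a| ^ 4 + |b| ^ 4) * |a - b|)
    {u v ψ : E3 → ℝ}
    (hu : MemLp u 6 (volume.restrict Ω)) (hv : MemLp v 6 (volume.restrict Ω))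
    (hψ : MemLp ψ 6 (volume.restrict Ω)) :
    Integrable (fun x => (f (u x) - f (v x)) * ψ x) (volume.restrict Ω) := by
  rw [← memLp_one_iff_integrable]
  refine ⟨((hf.comp_aestronglyMeasurable hu.1).sub (hf.comp_aestronglyMeasurable hv.1)).mul hψ.1,
    (eLpNorm_nonlinear_sub_mul_le hK (q := 3 / 2) (r := 6) (s := 6 / 5) (t := 6)
      one_le_three_halves hu.1 hv.1 hψ.1).trans_lt ?_⟩
  rw [three_halves_mul_four]
  refine ENNReal.mul_lt_top (ENNReal.mul_lt_top (ENNReal.mul_lt_top ENNReal.ofReal_lt_top ?_)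
    (hu.sub hv).2) hψ.2
  exact ENNReal.add_lt_top.2 ⟨ENNReal.add_lt_top.2 ⟨(memLp_const 1).2, ENNReal.pow_lt_top hu.2⟩,
      ENNReal.pow_lt_top hv.2⟩

/-- Real-valued form of `eLpNorm_nonlinear_sub_mul_le` on a set of finite measure. -/
theorem exists_abs_integral_nonlinear_sub_mul_le [IsFiniteMeasure (volume.restrict Ω)]
    {f : ℝ → ℝ} {K : ℝ} (hK0 : 0 ≤ K)
    (hK : ∀ a b, |f a - f b| ≤ K * (1 + |a| ^ 4 + |b| ^ 4) * |a - b|)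
    {q r : ℝ≥0∞} (hq : 1 ≤ q) [ENNReal.HolderTriple q r (6 / 5)] :
    ∃ C : ℝ, 0 ≤ C ∧ ∀ u v ψ : E3 → ℝ,
      MemLp u (q * 4) (volume.restrict Ω) → MemLp v (q * 4) (volume.restrict Ω) →
      MemLp (fun x => u x - v x) r (volume.restrict Ω) → MemLp ψ 6 (volume.restrict Ω) →
      |∫ x in Ω, (f (u x) - f (v x)) * ψ x| ≤
        C * (1 + (eLpNorm u (q * 4) (volume.restrict Ω)).toReal ^ 4
          + (eLpNorm v (q * 4) (volume.restrict Ω)).toReal ^ 4)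
          * (eLpNorm (fun x => u x - v x) r (volume.restrict Ω)).toReal
          * (eLpNorm ψ 6 (volume.restrict Ω)).toReal := by
  set μ := volume.restrict Ω
  set c := (eLpNorm (fun _ => (1 : ℝ)) q μ).toReal with hc
  refine ⟨K * (1 + c), by positivity, fun u v ψ hu hv huv hψ => ?_⟩
  have h1 := eLpNorm_nonlinear_sub_mul_le (μ := μ) hK (q := q) (r := r) (s := 6 / 5) (t := 6) hq
    hu.1 hv.1 hψ.1
  have hfin : eLpNorm (fun _ => (1 : ℝ)) q μ + eLpNorm u (q * 4) μ ^ 4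
      + eLpNorm v (q * 4) μ ^ 4 ≠ ⊤ :=
    ENNReal.add_ne_top.2 ⟨ENNReal.add_ne_top.2 ⟨(memLp_const 1).2.ne,
      (ENNReal.pow_lt_top hu.2).ne⟩, (ENNReal.pow_lt_top hv.2).ne⟩
  have h2 := ENNReal.toReal_mono (ENNReal.mul_ne_top (ENNReal.mul_ne_top (ENNReal.mul_ne_top
    ENNReal.ofReal_ne_top hfin) huv.2.ne) hψ.2.ne) h1
  simp only [ENNReal.toReal_mul, ENNReal.toReal_ofReal hK0] at h2
  rw [ENNReal.toReal_add (ENNReal.add_ne_top.1 hfin).1 (ENNReal.add_ne_top.1 hfin).2,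
    ENNReal.toReal_add (ENNReal.add_ne_top.1 (ENNReal.add_ne_top.1 hfin).1).1
      (ENNReal.add_ne_top.1 (ENNReal.add_ne_top.1 hfin).1).2, ENNReal.toReal_pow,
    ENNReal.toReal_pow, ← hc] at h2
  have h3 : |∫ x in Ω, (f (u x) - f (v x)) * ψ x| ≤
      (eLpNorm (fun x => (f (u x) - f (v x)) * ψ x) 1 μ).toReal := by
    rw [eLpNorm_one_eq_lintegral_enorm]
    have := norm_integral_le_lintegral_norm (μ := μ) (fun x => (f (u x) - f (v x)) * ψ x)
    simpa only [Real.norm_eq_abs, ← Real.enorm_eq_ofReal_abs] using this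
  refine h3.trans (h2.trans ?_)
  gcongr ?_ * _ * _
  set A := (eLpNorm u (q * 4) μ).toReal ^ 4
  set B := (eLpNorm v (q * 4) μ).toReal ^ 4
  have hA : 0 ≤ A := by positivity
  have hB : 0 ≤ B := by positivity
  have hc0 : 0 ≤ c := ENNReal.toReal_nonneg
  rw [mul_assoc]
  refine mul_le_mul_of_nonneg_left ?_ hK0
  nlinarith [mul_nonneg hc0 hA, mul_nonneg hc0 hB]

theorem H10.norm_val_le (p : H10 Ω) : ‖H10.val p‖ ≤ ‖p‖ :=
  WithLp.norm_fst_le _ (p : WithLp 2 (L2 Ω × L2vec Ω))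

theorem H10.val_add_ae (p q : H10 Ω) :
    H10.val (p + q) =ᵐ[volume.restrict Ω] fun x => H10.val p x + H10.val q x := by
  rw [map_add]
  exact Lp.coeFn_add _ _

theorem H10.val_sub_ae (p q : H10 Ω) :
    H10.val (p - q) =ᵐ[volume.restrict Ω] fun x => H10.val p x - H10.val q x := by
  rw [map_sub]
  exact Lp.coeFn_sub _ _

/-- `N p = f(p)`, as a map from `H¹₀(Ω)` to `H⁻¹(Ω)`. -/
structure IsNemytskii (f : ℝ → ℝ) (N : H10 Ω → Hneg1 Ω) : Prop where
  integrable : ∀ p ψ : H10 Ω, Integrable (fun x => f (H10.val p x) * H10.val ψ x) (volume.restrict Ω)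
  apply_eq : ∀ p ψ : H10 Ω, N p ψ = ∫ x in Ω, f (H10.val p x) * H10.val ψ x

/-- Split `f(p) = (f(p) - f 0) + f 0`. The difference estimate with second function `0` handles the
first term; the constant is in `L²` since the measure is finite. -/
theorem exists_isNemytskii [IsFiniteMeasure (volume.restrict Ω)] {f : ℝ → ℝ}
    (hf : QuinticGrowth f) : ∃ N : H10 Ω → Hneg1 Ω, IsNemytskii f N := by
  obtain ⟨K, hK0, hK⟩ := hf.exists_lipschitz
  obtain ⟨C, hC0, hC⟩ := exists_abs_integral_nonlinear_sub_mul_le (Ω := Ω) hK0 hK (q := 3 / 2)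
    (r := 6) one_le_three_halves
  rw [three_halves_mul_four] at hC
  obtain ⟨S, hS0, hS⟩ := H10.exists_eLpNorm_six_le Ω
  have hconst : MemLp (fun _ : E3 => (0 : ℝ)) 6 (volume.restrict Ω) := memLp_const 0
  have hi0 : ∀ p ψ : H10 Ω, Integrable (fun x => (f (H10.val p x) - f 0) * H10.val ψ x)
      (volume.restrict Ω) := fun p ψ =>
    integrable_nonlinear_sub_mul hf.contDiff.continuous hK (H10.memLp_six p) hconst (H10.memLp_six ψ)
  have hi1 : ∀ ψ : H10 Ω, Integrable (fun x => f 0 * H10.val ψ x) (volume.restrict Ω) := fun ψ =>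
    ((Lp.memLp (H10.val ψ)).integrable one_le_two).const_mul _
  have hi : ∀ p ψ : H10 Ω, Integrable (fun x => f (H10.val p x) * H10.val ψ x)
      (volume.restrict Ω) := fun p ψ => by
    refine ((hi0 p ψ).add (hi1 ψ)).congr (Filter.Eventually.of_forall fun x => ?_)
    simp only [Pi.add_apply]
    ring
  let L : H10 Ω → H10 Ω →ₗ[ℝ] ℝ := fun p =>
    { toFun := fun ψ => ∫ x in Ω, f (H10.val p x) * H10.val ψ x
      map_add' := fun ψ χ => by
        rw [← integral_add (hi p ψ) (hi p χ)]
        refine integral_congr_ae ?_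
        filter_upwards [H10.val_add_ae ψ χ] with x hx
        rw [hx, mul_add]
      map_smul' := fun c ψ => by
        rw [RingHom.id_apply, smul_eq_mul, ← integral_const_mul]
        refine integral_congr_ae ?_
        rw [map_smul]
        filter_upwards [Lp.coeFn_smul c (H10.val ψ)] with x hx
        rw [hx, Pi.smul_apply, smul_eq_mul]
        ring }
  have hL : ∀ p, ∃ B, ∀ ψ, ‖L p ψ‖ ≤ B * ‖ψ‖ := by
    intro p
    have hM : ∃ M, 0 ≤ M ∧ ∀ ψ : H10 Ω, |∫ x in Ω, f 0 * H10.val ψ x| ≤ M * ‖ψ‖ := by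
      set c : L2 Ω := (memLp_const (f 0)).toLp (fun _ => f 0) with hc
      refine ⟨‖c‖, norm_nonneg _, fun ψ => ?_⟩
      have e : ∫ x in Ω, f 0 * H10.val ψ x = inner ℝ c (H10.val ψ) := by
        rw [L2.inner_def]
        refine integral_congr_ae ?_
        filter_upwards [(memLp_const (μ := volume.restrict Ω) (p := 2) (f 0)).coeFn_toLp] with x hx
        rw [hc, hx]
        simp [mul_comm]
      rw [e]
      exact (abs_real_inner_le_norm _ _).trans
        (mul_le_mul_of_nonneg_left (H10.norm_val_le ψ) (norm_nonneg _))
    obtain ⟨M, hM0, hM⟩ := hM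
    set A := C * (1 + (eLpNorm (H10.val p) 6 (volume.restrict Ω)).toReal ^ 4
          + (eLpNorm (fun _ : E3 => (0 : ℝ)) 6 (volume.restrict Ω)).toReal ^ 4)
          * (eLpNorm (fun x => H10.val p x - 0) 6 (volume.restrict Ω)).toReal with hA
    have hA0 : 0 ≤ A := by positivity
    refine ⟨A * S + M, fun ψ => ?_⟩
    have h1 := hC (H10.val p) (fun _ => 0) (H10.val ψ) (H10.memLp_six p) hconst
      ((H10.memLp_six p).sub hconst) (H10.memLp_six ψ)
    have e : L p ψ = (∫ x in Ω, (f (H10.val p x) - f 0) * H10.val ψ x)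
        + ∫ x in Ω, f 0 * H10.val ψ x := by
      rw [← integral_add (hi0 p ψ) (hi1 ψ)]
      exact integral_congr_ae (Filter.Eventually.of_forall fun x => by ring)
    rw [e, add_mul]
    refine (norm_add_le _ _).trans (add_le_add ?_ (hM ψ))
    refine h1.trans ?_
    rw [mul_assoc A]
    refine mul_le_mul_of_nonneg_left ((hS ψ).trans ?_) hA0
    exact mul_le_mul_of_nonneg_left (H10.norm_grad_le ψ) hS0
  choose B hB using hL
  exact ⟨fun p => (L p).mkContinuous (B p) (hB p), hi, fun p ψ => rfl⟩

theorem IsNemytskii.sub_apply {f : ℝ → ℝ} {N : H10 Ω → Hneg1 Ω} (hN : IsNemytskii f N)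
    (p q ψ : H10 Ω) :
    (N p - N q) ψ = ∫ x in Ω, (f (H10.val p x) - f (H10.val q x)) * H10.val ψ x := by
  rw [_root_.sub_apply, hN.apply_eq, hN.apply_eq,
    ← integral_sub (hN.integrable p ψ) (hN.integrable q ψ)]
  exact integral_congr_ae (Filter.Eventually.of_forall fun x => by ring)

/-- Finite-energy estimate with exponents `3/2, 6, 6`. It provides continuity and boundedness of
`N`, hence integrability of `N (u t)` in time; its right-hand side contains the full `H¹` norm of `p
- q`, too strong for the Gronwall argument. -/
theorem IsNemytskii.exists_norm_sub_le [IsFiniteMeasure (volume.restrict Ω)] {f : ℝ → ℝ}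
    (hf : QuinticGrowth f) {N : H10 Ω → Hneg1 Ω} (hN : IsNemytskii f N) :
    ∃ C : ℝ, 0 ≤ C ∧ ∀ p q, ‖N p - N q‖ ≤ C * (1 + ‖p‖ ^ 4 + ‖q‖ ^ 4) * ‖p - q‖ := by
  obtain ⟨K, hK0, hK⟩ := hf.exists_lipschitz
  obtain ⟨C, hC0, hC⟩ := exists_abs_integral_nonlinear_sub_mul_le (Ω := Ω) hK0 hK (q := 3 / 2)
    (r := 6) one_le_three_halves
  rw [three_halves_mul_four] at hC
  obtain ⟨S, hS0, hS⟩ := H10.exists_eLpNorm_six_le Ω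
  have hS' : ∀ p : H10 Ω, (eLpNorm (H10.val p) 6 (volume.restrict Ω)).toReal ≤ S * ‖p‖ :=
    fun p => (hS p).trans (mul_le_mul_of_nonneg_left (H10.norm_grad_le p) hS0)
  refine ⟨C * (1 + S ^ 4) * S * S, by positivity, fun p q => ?_⟩
  refine ContinuousLinearMap.opNorm_le_bound _ (by positivity) fun ψ => ?_
  rw [hN.sub_apply, Real.norm_eq_abs]
  refine (hC _ _ _ (H10.memLp_six p) (H10.memLp_six q) ((H10.memLp_six p).sub (H10.memLp_six q)) (H10.memLp_six ψ)).trans ?_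
  rw [← eLpNorm_congr_ae (H10.val_sub_ae p q)]
  calc _ ≤ C * (1 + (S * ‖p‖) ^ 4 + (S * ‖q‖) ^ 4) * (S * ‖p - q‖) * (S * ‖ψ‖) := by
        gcongr <;> apply hS'
    _ ≤ C * ((1 + S ^ 4) * (1 + ‖p‖ ^ 4 + ‖q‖ ^ 4)) * (S * ‖p - q‖) * (S * ‖ψ‖) := by
        gcongr
        have : 0 ≤ S ^ 4 := by positivity
        have : 0 ≤ ‖p‖ ^ 4 + ‖q‖ ^ 4 := by positivity
        nlinarith
    _ = _ := by ring

theorem continuous_of_norm_sub_le {X Y : Type*} [NormedAddCommGroup X] [NormedAddCommGroup Y]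
    {F : X → Y} {C : ℝ} (h : ∀ p q, ‖F p - F q‖ ≤ C * (1 + ‖p‖ ^ 4 + ‖q‖ ^ 4) * ‖p - q‖) :
    Continuous F := by
  refine continuous_iff_continuousAt.2 fun p => tendsto_iff_norm_sub_tendsto_zero.2 ?_
  refine squeeze_zero (fun _ => norm_nonneg _) (fun q => h q p) ?_
  have : Continuous fun q : X => C * (1 + ‖q‖ ^ 4 + ‖p‖ ^ 4) * ‖q - p‖ := by fun_prop
  simpa using this.tendsto p

theorem IsNemytskii.continuous [IsFiniteMeasure (volume.restrict Ω)] {f : ℝ → ℝ}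
    (hf : QuinticGrowth f) {N : H10 Ω → Hneg1 Ω} (hN : IsNemytskii f N) : Continuous N := by
  obtain ⟨C, -, hC⟩ := hN.exists_norm_sub_le hf
  refine continuous_of_norm_sub_le (X := H10 Ω) (Y := Hneg1 Ω) (F := N) (C := C) fun p q => ?_
  exact hC p q

theorem IsNemytskii.exists_norm_le [IsFiniteMeasure (volume.restrict Ω)] {f : ℝ → ℝ}
    (hf : QuinticGrowth f) {N : H10 Ω → Hneg1 Ω} (hN : IsNemytskii f N) (M : ℝ) :
    ∃ B : ℝ, ∀ p, ‖p‖ ≤ M → ‖N p‖ ≤ B := by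
  obtain ⟨C, hC0, hC⟩ := hN.exists_norm_sub_le hf
  refine ⟨C * (1 + M ^ 4) * M + ‖N 0‖, fun p hp => ?_⟩
  have h1 := hC p 0
  have h2 : ‖N p‖ ≤ ‖N p - N 0‖ + ‖N 0‖ := by
    simpa using norm_add_le (N p - N 0) (N 0)
  refine h2.trans (add_le_add (h1.trans ?_) le_rfl)
  simp only [norm_zero, sub_zero, ne_eq, OfNat.ofNat_ne_zero, not_false_eq_true, zero_pow,
    add_zero]
  have : 0 ≤ M := (norm_nonneg p).trans hp
  gcongr

/-- The estimate of `f(p) - f(q)` by the `L²` norm of `p - q` for `p, q ∈ L¹²(Ω)`. -/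
theorem IsNemytskii.exists_abs_sub_apply_le [IsFiniteMeasure (volume.restrict Ω)] {f : ℝ → ℝ}
    (hf : QuinticGrowth f) {N : H10 Ω → Hneg1 Ω} (hN : IsNemytskii f N) :
    ∃ C : ℝ, 0 ≤ C ∧ ∀ (p q ψ : H10 Ω) (P Q : Lp ℝ 12 (volume.restrict Ω)),
      P =ᵐ[volume.restrict Ω] H10.val p → Q =ᵐ[volume.restrict Ω] H10.val q →
      |(N p - N q) ψ| ≤ C * (1 + ‖P‖ ^ 4 + ‖Q‖ ^ 4) * ‖H10.val (p - q)‖ * ‖H10.grad ψ‖ := by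
  obtain ⟨K, hK0, hK⟩ := hf.exists_lipschitz
  -- The choice `q = 3` consumes the `L¹²` norms and leaves only the `L²` norm of the difference.
  obtain ⟨C, hC0, hC⟩ := exists_abs_integral_nonlinear_sub_mul_le (Ω := Ω) hK0 hK (q := 3)
    (r := 2) (by norm_num)
  rw [show (3 * 4 : ℝ≥0∞) = 12 by norm_num] at hC
  obtain ⟨S, hS0, hS⟩ := H10.exists_eLpNorm_six_le Ω
  refine ⟨C * S, by positivity, fun p q ψ P Q hP hQ => ?_⟩
  rw [hN.sub_apply]
  refine (hC _ _ _ ((memLp_congr_ae hP).1 (Lp.memLp P)) ((memLp_congr_ae hQ).1 (Lp.memLp Q))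
    ((Lp.memLp _).sub (Lp.memLp _)) (H10.memLp_six ψ)).trans ?_
  rw [← eLpNorm_congr_ae (H10.val_sub_ae p q), ← eLpNorm_congr_ae hP, ← eLpNorm_congr_ae hQ,
    ← Lp.norm_def, ← Lp.norm_def, ← Lp.norm_def]
  calc _ ≤ C * (1 + ‖P‖ ^ 4 + ‖Q‖ ^ 4) * ‖H10.val (p - q)‖ * (S * ‖H10.grad ψ‖) := by
        gcongr
        exact hS ψ
    _ = _ := by ring

end Nemytskii

/-! ### From the distributional equation to an equation in `H⁻¹(Ω)` -/

section WeakForm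

variable {Ω : Set E3}

instance normedAddCommGroupHneg1 : NormedAddCommGroup (Hneg1 Ω) :=
  ContinuousLinearMap.toNormedAddCommGroup

instance normedSpaceHneg1 : NormedSpace ℝ (Hneg1 Ω) := ContinuousLinearMap.toNormedSpace

instance enormedAddMonoidHneg1 : ENormedAddMonoid (Hneg1 Ω) :=
  NormedAddGroup.toENormedAddMonoid

/-- The embedding `L²(Ω) → H⁻¹(Ω)` as a continuous linear map. -/
def toHneg1L (Ω : Set E3) : L2 Ω →L[ℝ] Hneg1 Ω :=
  (innerSL ℝ (E := L2 Ω) : L2 Ω →L[ℝ] L2 Ω →L[ℝ] ℝ).bilinearComp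
    (ContinuousLinearMap.id ℝ (L2 Ω)) H10.val

theorem toHneg1L_apply (w : L2 Ω) (ψ : H10 Ω) : toHneg1L Ω w ψ = inner ℝ w (H10.val ψ) := rfl

theorem toHneg1L_eq (w : L2 Ω) : toHneg1L Ω w = toHneg1 w := rfl

/-- The operator `-Δ : H¹₀(Ω) → H⁻¹(Ω)`. -/
def negLaplacian (Ω : Set E3) : H10 Ω →L[ℝ] Hneg1 Ω :=
  (innerSL ℝ (E := L2vec Ω) : L2vec Ω →L[ℝ] L2vec Ω →L[ℝ] ℝ).bilinearComp H10.grad H10.grad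

theorem negLaplacian_apply (p ψ : H10 Ω) :
    negLaplacian Ω p ψ = inner ℝ (H10.grad p) (H10.grad ψ) := rfl

theorem H10.eq_zero_of_testGraph {L : Hneg1 Ω}
    (h : ∀ ψ : H10 Ω, (ψ : WithLp 2 (L2 Ω × L2vec Ω)) ∈ testGraph Ω → L ψ = 0) : L = 0 := by
  ext p
  obtain ⟨x, hx, hlim⟩ := mem_closure_iff_seq_limit.1 p.2
  let y : ℕ → H10 Ω := fun n => ⟨x n, subset_closure (hx n)⟩
  have hy : Filter.Tendsto y Filter.atTop (𝓝 p) := tendsto_subtype_rng.2 hlim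
  have hL := (L.continuous.tendsto p).comp hy
  refine tendsto_nhds_unique hL ?_
  have : (L ∘ y) = fun _ => 0 := funext fun n => h (y n) (hx n)
  rw [this]
  exact tendsto_const_nhds

theorem IsTestFunction.prod {T : ℝ} {η : ℝ → ℝ} {ϕ : E3 → ℝ} (hη : IsTestFunction (Ioo 0 T) η)
    (hϕ : IsTestFunction Ω ϕ) :
    IsTestFunction (Ioo 0 T ×ˢ Ω) (Function.uncurry fun t x => η t * ϕ x) := by
  have hsub : tsupport (Function.uncurry fun t x => η t * ϕ x) ⊆ tsupport η ×ˢ tsupport ϕ := by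
    refine closure_minimal ?_ ((isClosed_tsupport _).prod (isClosed_tsupport _))
    rintro ⟨t, x⟩ h
    have h' : η t * ϕ x ≠ 0 := h
    exact ⟨subset_tsupport _ (left_ne_zero_of_mul h'), subset_tsupport _ (right_ne_zero_of_mul h')⟩
  refine ⟨?_, ?_, hsub.trans (prod_mono hη.support_subset hϕ.support_subset)⟩
  · exact (hη.smooth.comp contDiff_fst).mul (hϕ.smooth.comp contDiff_snd)
  · exact (hη.compact.isCompact.prod hϕ.compact.isCompact).of_isClosed_subset
      (isClosed_tsupport _) hsub

theorem gradient_const_mul {ϕ : E3 → ℝ} (c : ℝ) (hϕ : Differentiable ℝ ϕ) (x : E3) :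
    gradient (fun y => c * ϕ y) x = c • gradient ϕ x := by
  simp only [gradient, fderiv_const_mul (hϕ x), map_smul]

theorem integral_mul_eq_inner (w : L2 Ω) {ψ : L2 Ω} {ϕ : E3 → ℝ}
    (h : ψ =ᵐ[volume.restrict Ω] ϕ) (c : ℝ) : ∫ x in Ω, w x * (c * ϕ x) = c * inner ℝ w ψ := by
  rw [L2.inner_def, ← integral_const_mul]
  refine integral_congr_ae ?_
  filter_upwards [h] with x hx
  rw [hx]
  simp only [RCLike.inner_apply, conj_trivial]
  ring

theorem intervalIntegrable_of_memLp {X : Type*} [NormedAddCommGroup X] {T : ℝ} (hT : 0 < T)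
    {p : ENNReal} (hp : 1 ≤ p) {F : ℝ → X} (h : MemLp F p (timeMeasure T)) :
    IntervalIntegrable F volume 0 T := by
  rw [intervalIntegrable_iff_integrableOn_Ioo_of_le hT.le]
  exact h.integrable hp

theorem IsNemytskii.intervalIntegrable [IsFiniteMeasure (volume.restrict Ω)] {f : ℝ → ℝ}
    (hf : QuinticGrowth f) {N : H10 Ω → Hneg1 Ω} (hN : IsNemytskii f N) {T : ℝ} (hT : 0 < T)
    {u : ℝ → H10 Ω} (hu : MemLp u ⊤ (timeMeasure T)) :
    IntervalIntegrable (fun t => N (u t)) volume 0 T := by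
  rw [intervalIntegrable_iff_integrableOn_Ioo_of_le hT.le]
  obtain ⟨B, hB⟩ := hN.exists_norm_le hf (eLpNorm u ⊤ (timeMeasure T)).toReal
  refine Integrable.mono' (integrable_const B)
    ((hN.continuous hf).comp_aestronglyMeasurable hu.1) ?_
  have := ae_le_eLpNormEssSup (f := u) (μ := timeMeasure T)
  filter_upwards [this] with t ht
  refine hB _ ?_
  rw [← eLpNorm_exponent_top] at ht
  simpa using ENNReal.toReal_mono hu.2.ne ht

theorem intervalIntegrable_clm_comp {X Y : Type*} [NormedAddCommGroup X]
    [NormedSpace ℝ X] [NormedAddCommGroup Y] [NormedSpace ℝ Y] (L : X →L[ℝ] Y) {a b : ℝ}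
    {F : ℝ → X} (hF : IntervalIntegrable F volume a b) :
    IntervalIntegrable (fun t => L (F t)) volume a b := by
  rw [intervalIntegrable_iff] at hF ⊢
  exact L.integrable_comp hF

theorem intervalIntegral_eq_timeMeasure {X : Type*} [NormedAddCommGroup X] [NormedSpace ℝ X]
    {T : ℝ} (hT : 0 < T) (F : ℝ → X) : ∫ t in 0..T, F t = ∫ t in Ioo 0 T, F t := by
  rw [intervalIntegral.integral_of_le hT.le, integral_Ioc_eq_integral_Ioo]

/-- The equation as an identity in `H⁻¹(Ω)`, tested only in time. -/
theorem IsWeakSolution.integral_deriv_smul [IsFiniteMeasure (volume.restrict Ω)]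
    {T γ : ℝ} (hT : 0 < T) {f : ℝ → ℝ} (hf : QuinticGrowth f) {g : L2 Ω} {u₀ : H10 Ω} {u₁ : L2 Ω}
    {u : ℝ → H10 Ω} {ut : ℝ → L2 Ω} (hu : IsWeakSolution Ω T γ f g u₀ u₁ u ut)
    {N : H10 Ω → Hneg1 Ω} (hN : IsNemytskii f N) {η : ℝ → ℝ} (hη : IsTestFunction (Ioo 0 T) η) :
    ∫ t in 0..T, deriv η t • (toHneg1L Ω (ut t) + γ • toHneg1L Ω (H10.val (u t))) =
      -∫ t in 0..T, η t • -(negLaplacian Ω (u t) + N (u t) - toHneg1L Ω g) := by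
  have hui := intervalIntegrable_of_memLp hT le_top hu.memLp_u
  have huti := intervalIntegrable_of_memLp hT le_top hu.memLp_ut
  have i1 := intervalIntegrable_clm_comp (Y := Hneg1 Ω) (toHneg1L Ω) huti
  have i2 := intervalIntegrable_clm_comp (Y := Hneg1 Ω) (toHneg1L Ω) (intervalIntegrable_clm_comp (X := H10 Ω) (Y := L2 Ω) H10.val hui)
  have i3 := intervalIntegrable_clm_comp (X := H10 Ω) (Y := Hneg1 Ω) (negLaplacian Ω) hui
  have i4 := hN.intervalIntegrable hf hT hu.memLp_u
  have i5 : IntervalIntegrable (fun _ : ℝ => toHneg1L Ω g) volume 0 T := intervalIntegrable_const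
  have hη0 := hη.continuous.continuousOn (s := uIcc 0 T)
  have hη1 := hη.continuous_deriv.continuousOn (s := uIcc 0 T)
  have iL : IntervalIntegrable (fun t => deriv η t • (toHneg1L Ω (ut t)
      + γ • toHneg1L Ω (H10.val (u t)))) volume 0 T :=
    (i1.add (i2.smul γ)).continuousOn_smul hη1
  have iR : IntervalIntegrable (fun t => η t • -(negLaplacian Ω (u t) + N (u t) - toHneg1L Ω g))
      volume 0 T := (((i3.add i4).sub i5).neg).continuousOn_smul hη0
  rw [eq_neg_iff_add_eq_zero]
  -- Test functions are dense in `H10 Ω`, so it is enough to pair with them; the space-time test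
  -- function is then the product `η t * ϕ x`.
  refine H10.eq_zero_of_testGraph fun ψ hψ => ?_
  obtain ⟨ϕ, hϕ, hϕ1, hϕ2⟩ := hψ
  have hval : H10.val ψ =ᵐ[volume.restrict Ω] ϕ := hϕ1
  have hgrad : H10.grad ψ =ᵐ[volume.restrict Ω] gradient ϕ := hϕ2
  have heq := hu.equation _ (hη.prod hϕ)
  have hd : ∀ t x, deriv (fun s => η s * ϕ x) t = deriv η t * ϕ x := fun t x =>
    deriv_mul_const ((hη.smooth.differentiable (by simp)) t) _
  have e1 : ∀ t, ∫ x in Ω, ut t x * deriv (fun s => η s * ϕ x) t =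
      deriv η t * toHneg1L Ω (ut t) ψ := fun t => by
    simp only [hd]
    exact integral_mul_eq_inner _ hval _
  have e2 : ∀ t, ∫ x in Ω, H10.val (u t) x * deriv (fun s => η s * ϕ x) t =
      deriv η t * toHneg1L Ω (H10.val (u t)) ψ := fun t => by
    simp only [hd]
    exact integral_mul_eq_inner _ hval _
  have e3 : ∀ t, ∫ x in Ω, inner ℝ (H10.grad (u t) x) (gradient (fun y => η t * ϕ y) x) =
      η t * negLaplacian Ω (u t) ψ := fun t => by
    rw [negLaplacian_apply, L2.inner_def, ← integral_const_mul]
    refine integral_congr_ae ?_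
    filter_upwards [hgrad] with x hx
    rw [gradient_const_mul _ (hϕ.smooth.differentiable (by simp)), hx, inner_smul_right]
  have e4 : ∀ t, ∫ x in Ω, f (H10.val (u t) x) * (η t * ϕ x) = η t * N (u t) ψ := fun t => by
    rw [hN.apply_eq, ← integral_const_mul]
    refine integral_congr_ae ?_
    filter_upwards [hval] with x hx
    rw [hx]
    ring
  have e5 : ∀ t, ∫ x in Ω, g x * (η t * ϕ x) = η t * toHneg1L Ω g ψ := fun t =>
    integral_mul_eq_inner _ hval _
  simp only [e1, e2, e3, e4, e5, ← intervalIntegral_eq_timeMeasure hT] at heq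
  have happ : ∀ {F : ℝ → Hneg1 Ω}, IntervalIntegrable F volume 0 T →
      IntervalIntegrable (fun t => F t ψ) volume 0 T := fun hF =>
    intervalIntegrable_clm_comp (X := Hneg1 Ω) (ContinuousLinearMap.apply ℝ ℝ ψ) hF
  have j1 := (happ i1).continuousOn_mul hη1
  have j2 := (happ i2).continuousOn_mul hη1
  have j3 := (happ i3).continuousOn_mul hη0
  have j4 := (happ i4).continuousOn_mul hη0
  have j5 := (happ i5).continuousOn_mul hη0
  rw [add_apply, ContinuousLinearMap.intervalIntegral_apply iL,
    ContinuousLinearMap.intervalIntegral_apply iR]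
  have l1 : ∫ t in 0..T, (deriv η t • (toHneg1L Ω (ut t) + γ • toHneg1L Ω (H10.val (u t)))) ψ =
      (∫ t in 0..T, deriv η t * toHneg1L Ω (ut t) ψ)
      + γ * ∫ t in 0..T, deriv η t * toHneg1L Ω (H10.val (u t)) ψ := by
    rw [← intervalIntegral.integral_const_mul, ← intervalIntegral.integral_add j1 (j2.const_mul γ)]
    refine intervalIntegral.integral_congr fun t _ => ?_
    simp only [smul_apply, add_apply, smul_eq_mul]
    ring
  have l2 : ∫ t in 0..T, (η t • -(negLaplacian Ω (u t) + N (u t) - toHneg1L Ω g)) ψ =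
      -((∫ t in 0..T, η t * negLaplacian Ω (u t) ψ) + (∫ t in 0..T, η t * N (u t) ψ)
        - ∫ t in 0..T, η t * toHneg1L Ω g ψ) := by
    rw [← intervalIntegral.integral_add j3 j4, ← intervalIntegral.integral_sub (j3.add j4) j5,
      ← intervalIntegral.integral_neg]
    refine intervalIntegral.integral_congr fun t _ => ?_
    simp only [smul_apply, add_apply, sub_apply, neg_apply, smul_eq_mul]
    ring
  rw [l1, l2]
  linarith

end WeakForm

/-! ### Energy identity and uniqueness for the time-integrated equation -/

section Energy

variable {H L G : Type*} [NormedAddCommGroup H] [NormedSpace ℝ H] [CompleteSpace H]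
  [NormedAddCommGroup L] [InnerProductSpace ℝ L] [CompleteSpace L]
  [NormedAddCommGroup G] [InnerProductSpace ℝ G]

theorem continuousOn_primitive {X : Type*} [NormedAddCommGroup X] [NormedSpace ℝ X] {T : ℝ}
    {F : ℝ → X} (hT : 0 ≤ T) (hF : IntervalIntegrable F volume 0 T) :
    ContinuousOn (fun t => ∫ τ in 0..t, F τ) (Icc 0 T) := by
  rw [← uIcc_of_le hT]
  exact intervalIntegral.continuousOn_primitive_interval' hF left_mem_uIcc

/-- The identity obtained by testing the time-integrated equation with the solution. -/
theorem energy_identity {T γ : ℝ} (val : H →L[ℝ] L) (grad : H →L[ℝ] G) {w : ℝ → H}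
    {wt : ℝ → L} {h : ℝ → StrongDual ℝ H} (hw : IntervalIntegrable w volume 0 T)
    (hwt : IntervalIntegrable wt volume 0 T) (hh : IntervalIntegrable h volume 0 T)
    (hD : ∀ᵐ t ∂(timeMeasure T), val (w t) = ∫ τ in 0..t, wt τ)
    (hV : ∀ᵐ t ∂(timeMeasure T), ∀ ψ, inner ℝ (wt t) (val ψ)
      + γ * inner ℝ (∫ τ in 0..t, wt τ) (val ψ) + inner ℝ (grad (∫ τ in 0..t, w τ)) (grad ψ)
      + (∫ τ in 0..t, h τ) ψ = 0) {s : ℝ} (hs : s ∈ Icc 0 T) :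
    ‖∫ τ in 0..s, wt τ‖ ^ 2 / 2 + γ * (∫ t in 0..s, ‖∫ τ in 0..t, wt τ‖ ^ 2)
      + ‖grad (∫ τ in 0..s, w τ)‖ ^ 2 / 2 + ∫ t in 0..s, h t (∫ τ in t..s, w τ) = 0 := by
  have hsub : uIcc 0 s ⊆ uIcc 0 T :=
    uIcc_subset_uIcc_left (by rwa [uIcc_of_le (hs.1.trans hs.2)])
  replace hw := hw.mono_set hsub
  replace hwt := hwt.mono_set hsub
  replace hh := hh.mono_set hsub
  let BL : L →L[ℝ] L →L[ℝ] ℝ := innerSL ℝ (E := L)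
  let BG : H →L[ℝ] H →L[ℝ] ℝ :=
    (innerSL ℝ (E := G) : G →L[ℝ] G →L[ℝ] ℝ).bilinearComp grad grad
  have cw : ContinuousOn (fun t => ∫ τ in 0..t, w τ) (uIcc 0 s) :=
    intervalIntegral.continuousOn_primitive_interval' hw left_mem_uIcc
  have cwt : ContinuousOn (fun t => ∫ τ in 0..t, wt τ) (uIcc 0 s) :=
    intervalIntegral.continuousOn_primitive_interval' hwt left_mem_uIcc
  have ch : ContinuousOn (fun t => ∫ τ in 0..t, h τ) (uIcc 0 s) :=
    intervalIntegral.continuousOn_primitive_interval' hh left_mem_uIcc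
  have i1 : IntervalIntegrable (fun t => (inner ℝ (∫ τ in 0..t, wt τ) (wt t) : ℝ)) volume 0 s :=
    intervalIntegrable_bilin BL cwt hwt
  have i2 : IntervalIntegrable (fun t => γ * ‖∫ τ in 0..t, wt τ‖ ^ 2) volume 0 s :=
    ((cwt.norm.pow 2).intervalIntegrable).const_mul γ
  have i3 : IntervalIntegrable
      (fun t => (inner ℝ (grad (∫ τ in 0..t, w τ)) (grad (w t)) : ℝ)) volume 0 s :=
    intervalIntegrable_bilin BG cw hw
  have i4 : IntervalIntegrable (fun t => (∫ τ in 0..t, h τ) (w t)) volume 0 s :=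
    intervalIntegrable_bilin (ContinuousLinearMap.id ℝ (StrongDual ℝ H)) ch hw
  have e1 := bilin_primitive_self BL (fun x y => real_inner_comm _ _) hs.1 hwt
  have e3 := bilin_primitive_self BG (fun x y => real_inner_comm _ _) hs.1 hw
  -- This transfers the time integral from `h` to `w`, so that `h` is paired with an increment of
  -- `W`, whose gradient the energy controls.
  have e4 := integral_bilin_primitive (ContinuousLinearMap.id ℝ (StrongDual ℝ H)) hs.1 hh hw
  have e1' : ‖∫ τ in 0..s, wt τ‖ ^ 2 = 2 * ∫ t in 0..s, inner ℝ (∫ τ in 0..t, wt τ) (wt t) := by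
    rw [← real_inner_self_eq_norm_sq]
    exact e1
  have e3' : ‖grad (∫ τ in 0..s, w τ)‖ ^ 2 =
      2 * ∫ t in 0..s, inner ℝ (grad (∫ τ in 0..t, w τ)) (grad (w t)) := by
    rw [← real_inner_self_eq_norm_sq]
    exact e3
  have e4' : ∫ t in 0..s, (∫ τ in 0..t, h τ) (w t) = ∫ t in 0..s, h t (∫ τ in t..s, w τ) := e4
  have hsum : ∫ t in 0..s, (inner ℝ (∫ τ in 0..t, wt τ) (wt t) + γ * ‖∫ τ in 0..t, wt τ‖ ^ 2
      + inner ℝ (grad (∫ τ in 0..t, w τ)) (grad (w t)) + (∫ τ in 0..t, h τ) (w t)) = 0 := by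
    rw [intervalIntegral.integral_of_le hs.1, integral_Ioc_eq_integral_Ioo]
    refine integral_eq_zero_of_ae ?_
    have hr : ∀ {P : ℝ → Prop}, (∀ᵐ t ∂(timeMeasure T), P t) →
        ∀ᵐ t ∂(volume.restrict (Ioo 0 s)), P t := fun hP =>
      ae_restrict_of_ae_restrict_of_subset (Ioo_subset_Ioo le_rfl hs.2) hP
    filter_upwards [hr hD, hr hV] with t h1 h2
    -- The exceptional null set in `hV` does not depend on `ψ`, so `ψ` may be chosen as `w t`.
    have h3 := h2 (w t)
    rw [h1, real_inner_comm, real_inner_self_eq_norm_sq] at h3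
    exact h3
  rw [intervalIntegral.integral_add ((i1.add i2).add i3) i4,
    intervalIntegral.integral_add (i1.add i2) i3, intervalIntegral.integral_add i1 i2,
    intervalIntegral.integral_const_mul, e4'] at hsum
  rw [e1', e3']
  linarith

/-- Uniqueness for the time-integrated equation with a source controlled by the `L²` norm. -/
theorem ae_eq_zero_of_energy {T γ : ℝ} (hT : 0 < T) (hγ : 0 ≤ γ) (val : H →L[ℝ] L)
    (grad : H →L[ℝ] G) (hinj : ∀ p, val p = 0 → grad p = 0 → p = 0) {w : ℝ → H}
    {wt : ℝ → L} {h : ℝ → StrongDual ℝ H} {a : ℝ → ℝ} (hw : IntervalIntegrable w volume 0 T)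
    (hwt : IntervalIntegrable wt volume 0 T) (hh : IntervalIntegrable h volume 0 T)
    (ha : IntervalIntegrable a volume 0 T) (ha0 : ∀ t, 0 ≤ a t)
    (hD : ∀ᵐ t ∂(timeMeasure T), val (w t) = ∫ τ in 0..t, wt τ)
    (hV : ∀ᵐ t ∂(timeMeasure T), ∀ ψ, inner ℝ (wt t) (val ψ)
      + γ * inner ℝ (∫ τ in 0..t, wt τ) (val ψ) + inner ℝ (grad (∫ τ in 0..t, w τ)) (grad ψ)
      + (∫ τ in 0..t, h τ) ψ = 0)
    (hle : ∀ᵐ t ∂(timeMeasure T), ∀ ψ, |h t ψ| ≤ a t * ‖val (w t)‖ * ‖grad ψ‖) :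
    ∀ᵐ t ∂(timeMeasure T), w t = 0 ∧ wt t = 0 := by
  set D : ℝ → L := fun t => ∫ τ in 0..t, wt τ with hDdef
  set W : ℝ → H := fun t => ∫ τ in 0..t, w τ with hWdef
  have cD : ContinuousOn D (Icc 0 T) := continuousOn_primitive hT.le hwt
  have cW : ContinuousOn W (Icc 0 T) := continuousOn_primitive hT.le hw
  set e : ℝ → ℝ := fun t => √(‖D t‖ ^ 2 + ‖grad (W t)‖ ^ 2) with he
  have ce : ContinuousOn e (Icc 0 T) :=
    ((cD.norm.pow 2).add ((grad.continuous.comp_continuousOn cW).norm.pow 2)).sqrt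
  have hesq : ∀ t, e t ^ 2 = ‖D t‖ ^ 2 + ‖grad (W t)‖ ^ 2 := fun t => Real.sq_sqrt (by positivity)
  have heD : ∀ t, ‖D t‖ ≤ e t := fun t =>
    Real.le_sqrt_of_sq_le (le_add_of_nonneg_right (by positivity))
  have heW : ∀ t, ‖grad (W t)‖ ≤ e t := fun t =>
    Real.le_sqrt_of_sq_le (le_add_of_nonneg_left (by positivity))
  have he0 : ∀ t, e t = 0 → D t = 0 ∧ grad (W t) = 0 := fun t ht =>
    ⟨norm_le_zero_iff.1 ((heD t).trans ht.le), norm_le_zero_iff.1 ((heW t).trans ht.le)⟩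
  have hgron : ∀ t ∈ Icc 0 T, e t = 0 := by
    -- The factor `2` compensates the halves in the energy identity; the damping term is nonnegative
    -- and is dropped.
    refine eqOn_zero_of_sq_le_integral (a := fun t => 2 * a t) (ha.const_mul 2)
      (fun t => mul_nonneg two_pos.le (ha0 t)) ce (fun t => Real.sqrt_nonneg _) fun s hs => ?_
    have hid := energy_identity (γ := γ) val grad hw hwt hh hD hV hs
    have hγ' : 0 ≤ γ * ∫ t in 0..s, ‖∫ τ in 0..t, wt τ‖ ^ 2 :=
      mul_nonneg hγ (intervalIntegral.integral_nonneg hs.1 fun t _ => by positivity)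
    have hsub : uIcc 0 s ⊆ Icc 0 T := by
      rw [uIcc_of_le hs.1]
      exact Icc_subset_Icc le_rfl hs.2
    have hmono : uIcc 0 s ⊆ uIcc 0 T := by rwa [uIcc_of_le hT.le]
    have hbi : IntervalIntegrable (fun t => a t * (e t * (e s + e t))) volume 0 s :=
      (ha.mono_set hmono).mul_continuousOn
        ((ce.mul (continuousOn_const.add ce)).mono hsub)
    have hb : ‖∫ t in 0..s, h t (∫ τ in t..s, w τ)‖ ≤ ∫ t in 0..s, a t * (e t * (e s + e t)) := by
      refine intervalIntegral.norm_integral_le_of_norm_le hs.1 ?_ hbi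
      have h1 : ∀ᵐ t ∂(volume : Measure ℝ), t ∈ Ioo 0 T →
          val (w t) = D t ∧ ∀ ψ, |h t ψ| ≤ a t * ‖val (w t)‖ * ‖grad ψ‖ := by
        rw [← ae_restrict_iff' measurableSet_Ioo]
        exact hD.and hle
      -- The integral runs over `(0, s]`, while the hypotheses concern `(0, T)`; the endpoint
      -- matters when `s = T`.
      have h2 : ∀ᵐ t ∂(volume : Measure ℝ), t ≠ T := by
        simp [ae_iff]
      filter_upwards [h1, h2] with t ht htT hts
      have htT' : t < T := lt_of_le_of_ne (hts.2.trans hs.2) htT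
      obtain ⟨hv, hb⟩ := ht ⟨hts.1, htT'⟩
      have hWst : ∫ τ in t..s, w τ = W s - W t := by
        simp only [hWdef]
        rw [intervalIntegral.integral_interval_sub_left (hw.mono_set hmono)
          (hw.mono_set (uIcc_subset_uIcc_left
            (by rw [uIcc_of_le hT.le]; exact ⟨hts.1.le, htT'.le⟩)))]
      rw [hWst, Real.norm_eq_abs]
      refine (hb _).trans ?_
      rw [hv, mul_assoc, map_sub]
      refine mul_le_mul_of_nonneg_left ?_ (ha0 t)
      refine mul_le_mul (heD t) ?_ (norm_nonneg _) (Real.sqrt_nonneg _)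
      exact (norm_sub_le _ _).trans (add_le_add (heW s) (heW t))
    have hb' := (abs_le.1 hb).1
    have e2 : ∫ t in 0..s, 2 * a t * (e t * (e s + e t))
        = 2 * ∫ t in 0..s, a t * (e t * (e s + e t)) := by
      rw [← intervalIntegral.integral_const_mul]
      simp only [mul_assoc]
    rw [hesq, e2]
    simp only [hDdef, hWdef]
    linarith
  have hD0 : ∀ t ∈ Icc 0 T, D t = 0 := fun t ht => (he0 t (hgron t ht)).1
  have hW0 : ∀ t ∈ Icc 0 T, W t = 0 := by
    intro t ht
    -- The vanishing gradient of `W` is supplemented by `val (W t) = ∫₀ᵗ val w = ∫₀ᵗ D = 0`, so no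
    -- Poincaré inequality is needed.
    refine hinj _ ?_ (he0 t (hgron t ht)).2
    have hwi : IntervalIntegrable w volume 0 t :=
      hw.mono_set (uIcc_subset_uIcc_left (by rwa [uIcc_of_le hT.le]))
    simp only [hWdef]
    rw [← ContinuousLinearMap.intervalIntegral_comp_comm _ hwi,
      intervalIntegral.integral_of_le ht.1, integral_Ioc_eq_integral_Ioo]
    refine integral_eq_zero_of_ae ?_
    have hr := ae_restrict_of_ae_restrict_of_subset (Ioo_subset_Ioo le_rfl ht.2) hD
    filter_upwards [hr, ae_restrict_mem measurableSet_Ioo] with τ h1 h2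
    rw [h1]
    exact hD0 τ ⟨h2.1.le, h2.2.le.trans ht.2⟩
  exact (ae_eq_zero_of_primitive_eq_zero hT hw hW0).and
    (ae_eq_zero_of_primitive_eq_zero hT hwt hD0)

end Energy

/-! ### Uniqueness of Shatah–Struwe solutions -/

section Uniqueness

variable {Ω : Set E3}

instance completeSpaceH10 : CompleteSpace (H10 Ω) :=
  (Submodule.isClosed_topologicalClosure (testGraph Ω)).completeSpace_coe

theorem H10.eq_zero_of_val_grad (p : H10 Ω) (h₁ : H10.val p = 0) (h₂ : H10.grad p = 0) :
    p = 0 := by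
  refine Subtype.ext (WithLp.ofLp_injective 2 (Prod.ext ?_ ?_))
  · exact h₁
  · exact h₂

theorem IsBoundedSmoothDomain.isFiniteMeasure (h : IsBoundedSmoothDomain Ω) :
    IsFiniteMeasure (volume.restrict Ω) :=
  ⟨by simpa using h.isBounded.measure_lt_top⟩

variable {T γ : ℝ} {f : ℝ → ℝ} {g : L2 Ω} {u₀ : H10 Ω} {u₁ : L2 Ω}
  {u : ℝ → H10 Ω} {ut : ℝ → L2 Ω}

theorem ae_mem_Icc_timeMeasure (T : ℝ) : ∀ᵐ t ∂(timeMeasure T), t ∈ Icc 0 T :=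
  (ae_restrict_mem measurableSet_Ioo).mono fun _ ht => Ioo_subset_Icc_self ht

theorem integral_smul_congr_timeMeasure {X : Type*} [NormedAddCommGroup X] [NormedSpace ℝ X]
    (hT : 0 < T) (η : ℝ → ℝ) {F F' : ℝ → X} (h : ∀ᵐ t ∂(timeMeasure T), F t = F' t) :
    ∫ t in 0..T, η t • F t = ∫ t in 0..T, η t • F' t := by
  rw [intervalIntegral_eq_timeMeasure hT, intervalIntegral_eq_timeMeasure hT]
  refine integral_congr_ae ?_
  filter_upwards [h] with t ht
  rw [ht]

theorem IsWeakSolution.val_ae_eq (hT : 0 < T) (hu : IsWeakSolution Ω T γ f g u₀ u₁ u ut) :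
    ∀ᵐ t ∂(timeMeasure T), H10.val (u t) = H10.val u₀ + ∫ τ in 0..t, ut τ := by
  obtain ⟨U, hUc, hU, hU0⟩ := hu.initial.1
  have key := eq_add_primitive_of_weakDeriv hT hUc
    (intervalIntegrable_of_memLp hT le_top hu.memLp_ut) fun η hη => by
      rw [integral_smul_congr_timeMeasure hT _ hU, intervalIntegral_eq_timeMeasure hT,
        intervalIntegral_eq_timeMeasure hT]
      exact hu.timeDeriv η hη
  filter_upwards [hU, ae_mem_Icc_timeMeasure T] with t h1 h2
  rw [← h1, key t h2, hU0]

/-- The equation integrated in time, as an identity in `H⁻¹(Ω)`. -/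
theorem IsWeakSolution.toHneg1L_ae_eq [IsFiniteMeasure (volume.restrict Ω)] (hT : 0 < T)
    (hf : QuinticGrowth f) (hu : IsWeakSolution Ω T γ f g u₀ u₁ u ut)
    {N : H10 Ω → Hneg1 Ω} (hN : IsNemytskii f N) :
    ∀ᵐ t ∂(timeMeasure T), toHneg1L Ω (ut t) + γ • toHneg1L Ω (H10.val (u t)) =
      toHneg1L Ω u₁ + γ • toHneg1L Ω (H10.val u₀) +
        ∫ τ in 0..t, -(negLaplacian Ω (u τ) + N (u τ) - toHneg1L Ω g) := by
  obtain ⟨U, hUc, hU, hU0⟩ := hu.initial.1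
  obtain ⟨V, hVc, hV, hV0⟩ := hu.initial.2
  have hae : ∀ᵐ t ∂(timeMeasure T), V t + γ • toHneg1L Ω (U t) =
      toHneg1L Ω (ut t) + γ • toHneg1L Ω (H10.val (u t)) := by
    filter_upwards [hU, hV] with t h1 h2
    rw [h1, h2, toHneg1L_eq (ut t)]
  -- The du Bois-Reymond lemma is applied to this continuous representative, whose value at `0`
  -- carries the initial data.
  have hc : ContinuousOn (fun t => V t + γ • toHneg1L Ω (U t)) (Icc 0 T) :=
    hVc.add (((toHneg1L Ω).continuous.comp_continuousOn hUc).const_smul γ)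
  have hui := intervalIntegrable_of_memLp hT le_top hu.memLp_u
  have i3 := intervalIntegrable_clm_comp (X := H10 Ω) (Y := Hneg1 Ω) (negLaplacian Ω) hui
  have i4 := hN.intervalIntegrable hf hT hu.memLp_u
  have i5 : IntervalIntegrable (fun _ : ℝ => toHneg1L Ω g) volume 0 T := intervalIntegrable_const
  have key := eq_add_primitive_of_weakDeriv (X := Hneg1 Ω) hT hc ((i3.add i4).sub i5).neg
    fun η hη => by
      rw [integral_smul_congr_timeMeasure (X := Hneg1 Ω) hT _ hae]
      exact hu.integral_deriv_smul hT hf hN hη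
  filter_upwards [hae, ae_mem_Icc_timeMeasure T] with t h1 h2
  have h3 := key t h2
  rw [h1, hU0, hV0, ← toHneg1L_eq] at h3
  exact h3

theorem IsShatahStruweSolution.ae_eq (hΩ : IsBoundedSmoothDomain Ω) (hT : 0 < T) (hγ : 0 ≤ γ)
    (hf : QuinticGrowth f) {v : ℝ → H10 Ω} {vt : ℝ → L2 Ω}
    (hu : IsShatahStruweSolution Ω T γ f g u₀ u₁ u ut)
    (hv : IsShatahStruweSolution Ω T γ f g u₀ u₁ v vt) :
    ∀ᵐ t ∂(timeMeasure T), u t = v t ∧ ut t = vt t := by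
  have := hΩ.isFiniteMeasure
  obtain ⟨N, hN⟩ := exists_isNemytskii (Ω := Ω) hf
  obtain ⟨C, hC0, hC⟩ := hN.exists_abs_sub_apply_le hf
  obtain ⟨P, hPm, hP⟩ := hu.strichartz
  obtain ⟨Q, hQm, hQ⟩ := hv.strichartz
  have hui := intervalIntegrable_of_memLp hT le_top hu.memLp_u
  have hvi := intervalIntegrable_of_memLp hT le_top hv.memLp_u
  have huti := intervalIntegrable_of_memLp hT le_top hu.memLp_ut
  have hvti := intervalIntegrable_of_memLp hT le_top hv.memLp_ut
  have hNu := hN.intervalIntegrable hf hT hu.memLp_u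
  have hNv := hN.intervalIntegrable hf hT hv.memLp_u
  have hAu := intervalIntegrable_clm_comp (X := H10 Ω) (Y := Hneg1 Ω) (negLaplacian Ω) hui
  have hAv := intervalIntegrable_clm_comp (X := H10 Ω) (Y := Hneg1 Ω) (negLaplacian Ω) hvi
  have i5 : IntervalIntegrable (fun _ : ℝ => toHneg1L Ω g) volume 0 T := intervalIntegrable_const
  have hpow : ∀ {R : ℝ → Lp ℝ 12 (volume.restrict Ω)}, MemLp R 4 (timeMeasure T) →
      IntervalIntegrable (fun t => ‖R t‖ ^ 4) volume 0 T := by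
    intro R hR
    rw [intervalIntegrable_iff_integrableOn_Ioo_of_le hT.le]
    exact hR.integrable_norm_pow (by norm_num)
  have ha : IntervalIntegrable (fun t => C * (1 + ‖P t‖ ^ 4 + ‖Q t‖ ^ 4)) volume 0 T :=
    ((intervalIntegrable_const.add (hpow hPm)).add (hpow hQm)).const_mul C
  have hmono : ∀ {t}, t ∈ Icc 0 T → uIcc 0 t ⊆ uIcc 0 T := fun ht =>
    uIcc_subset_uIcc_left (by rwa [uIcc_of_le hT.le])
  have hD : ∀ᵐ t ∂(timeMeasure T), H10.val (u t - v t) = ∫ τ in 0..t, (ut τ - vt τ) := by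
    filter_upwards [hu.val_ae_eq hT, hv.val_ae_eq hT, ae_mem_Icc_timeMeasure T] with t h1 h2 ht
    rw [map_sub, h1, h2, intervalIntegral.integral_sub (huti.mono_set (hmono ht))
      (hvti.mono_set (hmono ht)), add_sub_add_left_eq_sub]
  have hV : ∀ᵐ t ∂(timeMeasure T), ∀ ψ : H10 Ω, inner ℝ (ut t - vt t) (H10.val ψ)
      + γ * inner ℝ (∫ τ in 0..t, (ut τ - vt τ)) (H10.val ψ)
      + inner ℝ (H10.grad (∫ τ in 0..t, (u τ - v τ))) (H10.grad ψ)
      + (∫ τ in 0..t, (N (u τ) - N (v τ))) ψ = 0 := by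
    filter_upwards [hu.toHneg1L_ae_eq hT hf hN, hv.toHneg1L_ae_eq hT hf hN, hD,
      ae_mem_Icc_timeMeasure T] with t h1 h2 h3 ht ψ
    have hm := hmono ht
    -- In the difference of the two integrated equations `g` cancels here, and the common initial
    -- data cancel in `h5`.
    have h4 : (∫ τ in 0..t, -(negLaplacian Ω (u τ) + N (u τ) - toHneg1L Ω g))
        - (∫ τ in 0..t, -(negLaplacian Ω (v τ) + N (v τ) - toHneg1L Ω g))
        = -(negLaplacian Ω (∫ τ in 0..t, (u τ - v τ)) + ∫ τ in 0..t, (N (u τ) - N (v τ))) := by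
      rw [← ContinuousLinearMap.intervalIntegral_comp_comm _ ((hui.sub hvi).mono_set hm)]
      have iA : IntervalIntegrable (fun τ => negLaplacian Ω (u τ - v τ)) volume 0 t :=
        intervalIntegrable_clm_comp (X := H10 Ω) (Y := Hneg1 Ω) (negLaplacian Ω)
          ((hui.sub hvi).mono_set hm)
      have iu : IntervalIntegrable (fun τ => -(negLaplacian Ω (u τ) + N (u τ) - toHneg1L Ω g))
          volume 0 t := ((hAu.add hNu).sub i5).neg.mono_set hm
      have iv : IntervalIntegrable (fun τ => -(negLaplacian Ω (v τ) + N (v τ) - toHneg1L Ω g))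
          volume 0 t := ((hAv.add hNv).sub i5).neg.mono_set hm
      rw [← intervalIntegral.integral_add iA ((hNu.sub hNv).mono_set hm),
        ← intervalIntegral.integral_neg, ← intervalIntegral.integral_sub iu iv]
      refine intervalIntegral.integral_congr fun τ _ => ?_
      simp only [map_sub]
      abel
    have h5 := congrArg (fun L : Hneg1 Ω => L ψ) (congrArg₂ (· - ·) h1 h2)
    simp only [add_sub_add_left_eq_sub, h4] at h5
    simp only [sub_apply, add_apply, neg_apply, smul_apply, smul_eq_mul, toHneg1L_apply,
      negLaplacian_apply] at h5
    rw [← h3, map_sub, inner_sub_left, inner_sub_left]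
    linarith
  have hle : ∀ᵐ t ∂(timeMeasure T), ∀ ψ : H10 Ω, |(N (u t) - N (v t)) ψ| ≤
      C * (1 + ‖P t‖ ^ 4 + ‖Q t‖ ^ 4) * ‖H10.val (u t - v t)‖ * ‖H10.grad ψ‖ := by
    filter_upwards [hP, hQ] with t h1 h2 ψ
    exact hC _ _ _ _ _ h1 h2
  have key := ae_eq_zero_of_energy (H := H10 Ω) (L := L2 Ω) (G := L2vec Ω) hT hγ H10.val H10.grad
    H10.eq_zero_of_val_grad (hui.sub hvi) (huti.sub hvti) (hNu.sub hNv) ha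
    (fun t => by positivity) hD hV hle
  filter_upwards [key] with t ht
  exact ⟨sub_eq_zero.1 ht.1, sub_eq_zero.1 ht.2⟩

end Uniqueness

end DampedWave

end

theorem mainTheorem10 (Ω : Set DampedWave.E3) (hΩ : DampedWave.IsBoundedSmoothDomain Ω)
    (T : ℝ) (hT : 0 < T) (γ : ℝ) (hγ : 0 < γ)
    (f : ℝ → ℝ) (hf : DampedWave.QuinticGrowth f) (g : DampedWave.L2 Ω)
    (u₀ : DampedWave.H10 Ω) (u₁ : DampedWave.L2 Ω)
    (u v : ℝ → DampedWave.H10 Ω) (ut vt : ℝ → DampedWave.L2 Ω)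
    (hu : DampedWave.IsShatahStruweSolution Ω T γ f g u₀ u₁ u ut)
    (hv : DampedWave.IsShatahStruweSolution Ω T γ f g u₀ u₁ v vt) :
    ∀ᵐ t ∂(DampedWave.timeMeasure T), u t = v t ∧ ut t = vt t :=
  hu.ae_eq hΩ hT hγ.le hf hv
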